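/- Let $\mathcal D$ be a multifusion category over $\mathbb C$: a $\mathbb C$-linear abelian rigid monoidal category with bilinear tensor product, finite-dimensional morphism spaces, finitely many isomorphism classes of simple objects ($\operatorname{Irr}(\mathcal D)$ denotes a set of representatives), and every object a finite direct sum of simple ones. The unit $\mathbf 1$ need not be simple, and $\mathcal D$ may in particular be a unitary multifusion category. **Tube spaces.** For $m_0,m_1,n_0,n_1\in\mathbb N$ let $\mathbf T^{m_0,m_1;n_0,n_1}$ be the vector space spanned by tube string-nets: around a hole, a left (red) arc with $m_0$ internal and $m_1$ external legs and a right (blue) arc with $n_0$ internal and $n_1$ external legs run from a lower to an upper vertical line, all edges being labelled by $\operatorname{Irr}(\mathcal D)$ and vertices by morphisms. With diagrams read upwards, legs directed from inside to outside and each piece of the net evaluated to a morphism, $$\mathbf T^{m_0,m_1;n_0,n_1}=\bigoplus \operatorname{Hom}\big(y,(\alpha\otimes v)\otimes\beta\big)\otimes\operatorname{Hom}\big(\alpha\otimes C,\,A\otimes\alpha'\big)\otimes\operatorname{Hom}\big(D\otimes\beta,\,\beta'\otimes B\big)\otimes\operatorname{Hom}\big((\alpha'\otimes u)\otimes\beta',x\big),$$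 the sum running over simple outer vertical edges $x,y$, inner vertical edges $u,v$, first and last arc segments $\alpha,\alpha',\beta,\beta'$, and legs $a_i,b_j$ (external) and $c_i,d_j$ (internal), where $A=a_{m_1}\otimes\cdots\otimes a_1$, $C=c_{m_0}\otimes\cdots\otimes c_1$, $B=b_1\otimes\cdots\otimes b_{n_1}$, $D=d_1\otimes\cdots\otimes d_{n_0}$. **Stacking.** Placing a diagram of $\mathbf T^{m,s;n,t}$ around one of $\mathbf T^{p,m;q,n}$ gives $0$ unless the labels $(u,v,c_i,d_j)$ of the inner circle of the first equal the labels $(x,y,a_i,b_j)$ of the outer circle of the second. If they agree, one composes the morphisms along the common edges, obtaining a diagram whose arc segments are tensor products $\alpha_1\otimes\alpha_2$ (red) and $\beta_2\otimes\beta_1$ (blue), and returns to simple edges by resolving the identity of each such segment as $\sum_k \iota_k\pi_k$ over simple summands (the parallel move). This is a bilinear map $\mathbf T^{m,s;n,t}\times\mathbf T^{p,m;q,n}\to\mathbf T^{p,s;q,t}$. Let $1_{m,n}\in\mathbf T^{m,m;n,n}$ be the sum, over all labels of the legs and vertical edges, of the diagrams whose arcs are labelled by $\mathbf 1$ (decomposed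 into simple summands) and whose legs and vertical edges run straight through. The bulk tube algebra $\mathbf{Tube}({}_{\mathcal D}\mathcal D_{\mathcal D})$ is $\bigoplus\operatorname{Hom}(y,(a\otimes v)\otimes b)\otimes\operatorname{Hom}((a\otimes u)\otimes b,x)$, over $a,b,x,y,u,v\in\operatorname{Irr}(\mathcal D)$, with the analogous stacking multiplication and unit. **Theorem.** For all $m,n,s,t\in\mathbb N$: 1. $\mathbf T^{m,m;n,n}$ is an associative unital $\mathbb C$-algebra under stacking, with unit $1_{m,n}$. 2. $\mathbf T^{m,s;n,t}$ is a left-$\mathbf T^{s,s;t,t}$ right-$\mathbf T^{m,m;n,n}$ bimodule, the actions being stacking on the outside and on the inside. Moreover, stacking of any three composable tubes is associative. 3. Stacking induces isomorphisms of bimodules $$\mathbf T^{m,s;n,t}\otimes_{\mathbf T^{m,m;n,n}}\mathbf T^{s,m;t,n}\cong\mathbf T^{s,s;t,t},\qquad \mathbf T^{s,m;t,n}\otimes_{\mathbf T^{s,s;t,t}}\mathbf T^{m,s;n,t}\cong\mathbf T^{m,m;n,n},$$ so that these bimodules form a Morita context. 4. $\mathbf T^{m,m;n,n}$ and $\mathbf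 T^{s,s;t,t}$ are Morita equivalent: their module categories are $\mathbb C$-linearly equivalent. 5. $\mathbf T^{0,0;0,0}$ is the bulk tube algebra: regarding a legless edge $a$ (resp. $b$) as a red (resp. blue) arc without legs is an algebra isomorphism $\mathbf{Tube}({}_{\mathcal D}\mathcal D_{\mathcal D})\to\mathbf T^{0,0;0,0}$. Hence all $\mathbf T^{m,m;n,n}$ are Morita equivalent to the bulk tube algebra. -/

import Mathlib

open CategoryTheory MonoidalCategory TensorProduct

universe v u

noncomputable section

/-! ### Multifusion categories and their simple objects -/

/-- Isomorphism of simple objects. -/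
def simpleSetoid (D : Type u) [Category.{v} D] [Limits.HasZeroMorphisms D] :
    Setoid {X : D // Simple X} where
  r X Y := Nonempty (X.1 ≅ Y.1)
  iseqv :=
    { refl := fun X => ⟨Iso.refl X.1⟩
      symm := fun ⟨e⟩ => ⟨e.symm⟩
      trans := fun ⟨e⟩ ⟨f⟩ => ⟨e.trans f⟩ }

/-- `Irr(D)`: the isomorphism classes of simple objects. -/
def Irr (D : Type u) [Category.{v} D] [Limits.HasZeroMorphisms D] : Type u :=
  Quotient (simpleSetoid D)

/-- The representative of an isomorphism class of simple objects. -/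
def Irr.obj {D : Type u} [Category.{v} D] [Limits.HasZeroMorphisms D] (a : Irr D) : D :=
  (Quotient.out (s := simpleSetoid D) a).1

instance {D : Type u} [Category.{v} D] [Limits.HasZeroMorphisms D] : DecidableEq (Irr D) :=
  Classical.decEq _

attribute [local instance] Abelian.hasFiniteBiproducts

/-- A `ℂ`-linear abelian category with a bilinear rigid monoidal structure is a multifusion
category if its morphism spaces are finite-dimensional, every object is a finite direct sum of
simple objects, and there are finitely many isomorphism classes of simple objects. The tensor
unit is not required to be simple. -/
class IsMultifusion (D : Type u) [Category.{v} D] [Abelian D] [Linear ℂ D]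
    [MonoidalCategory D] [MonoidalPreadditive D] [MonoidalLinear ℂ D] [RigidCategory D] :
    Prop where
  finiteDimensional : ∀ X Y : D, FiniteDimensional ℂ (X ⟶ Y)
  semisimple : ∀ X : D, ∃ (n : ℕ) (S : Fin n → D), (∀ i, Simple (S i)) ∧ Nonempty (X ≅ ⨁ S)
  finite_irr : Finite (Irr D)

section

variable {D : Type u} [Category.{v} D] [Abelian D]

/-- A decomposition of the object `A` as a direct sum of members of `Irr(D)`. -/
structure SimpleDecomposition (A : D) where
  /-- the number of summands -/
  n : ℕ
  /-- the summands -/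
  label : Fin n → Irr D
  /-- the inclusions -/
  inj : ∀ i, (label i).obj ⟶ A
  /-- the projections -/
  proj : ∀ i, A ⟶ (label i).obj
  inj_proj_self : ∀ i, inj i ≫ proj i = 𝟙 _
  inj_proj_ne : ∀ i j, i ≠ j → inj i ≫ proj j = 0
  total : ∑ i, proj i ≫ inj i = 𝟙 A

variable [Linear ℂ D] [MonoidalCategory D] [MonoidalPreadditive D] [MonoidalLinear ℂ D]
  [RigidCategory D] [IsMultifusion D]

instance : Fintype (Irr D) :=
  haveI := IsMultifusion.finite_irr (D := D)
  Fintype.ofFinite _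

theorem nonempty_simpleDecomposition (A : D) : Nonempty (SimpleDecomposition A) := by
  obtain ⟨n, S, hS, ⟨e⟩⟩ := IsMultifusion.semisimple A
  let cls : Fin n → Irr D := fun i => Quotient.mk (simpleSetoid D) ⟨S i, hS i⟩
  have h : ∀ i, Nonempty ((cls i).obj ≅ S i) := fun i =>
    Quotient.mk_out (s := simpleSetoid D) (⟨S i, hS i⟩ : {X : D // Simple X})
  let f : ∀ i, (cls i).obj ≅ S i := fun i => (h i).some
  refine ⟨⟨n, cls, fun i => (f i).hom ≫ Limits.biproduct.ι S i ≫ e.inv,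
    fun i => e.hom ≫ Limits.biproduct.π S i ≫ (f i).inv, ?_, ?_, ?_⟩⟩
  · intro i
    simp
  · intro i j hij
    simp [Limits.biproduct.ι_π_ne_assoc S hij]
  · have : ∑ i, Limits.biproduct.π S i ≫ Limits.biproduct.ι S i = 𝟙 (⨁ S) :=
      Limits.biproduct.total
    calc _ = e.hom ≫ (∑ i, Limits.biproduct.π S i ≫ Limits.biproduct.ι S i) ≫ e.inv := by
            rw [Preadditive.sum_comp, Preadditive.comp_sum]
            simp
      _ = 𝟙 A := by rw [this]; simp

/-- A chosen decomposition of an object into simple objects. The results of the parallel moves below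
do not depend on the choice. -/
def simpleDecomposition (A : D) : SimpleDecomposition A :=
  (nonempty_simpleDecomposition A).some

end

/-! ### Tube diagrams -/

section

variable (D : Type u) [Category.{v} D] [Abelian D] [Linear ℂ D] [MonoidalCategory D]

/-- The labels on one of the two boundary circles of a tube with `m` red and `n` blue legs there:
the legs (numbered from top to bottom), and the vertical edge at the top and at the bottom. -/
@[ext] structure TubeBoundary (m n : ℕ) where
  /-- the red legs, on the left -/
  red : Fin m → Irr D
  /-- the blue legs, on the right -/
  blue : Fin n → Irr D
  /-- the upper vertical edge -/
  top : Irr D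
  /-- the lower vertical edge -/
  bot : Irr D

/-- The labels of the first and last segment of the red arc and of the blue arc. -/
@[ext] structure TubeArcs where
  /-- the red arc where it leaves the lower vertical edge -/
  redBot : Irr D
  /-- the red arc where it joins the upper vertical edge -/
  redTop : Irr D
  /-- the blue arc where it leaves the lower vertical edge -/
  blueBot : Irr D
  /-- the blue arc where it joins the upper vertical edge -/
  blueTop : Irr D

instance (m n : ℕ) : DecidableEq (TubeBoundary D m n) := Classical.decEq _
instance : DecidableEq (TubeArcs D) := Classical.decEq _

instance [MonoidalPreadditive D] [MonoidalLinear ℂ D] [RigidCategory D] [IsMultifusion D]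
    (m n : ℕ) : Fintype (TubeBoundary D m n) :=
  Fintype.ofInjective
    (fun b : TubeBoundary D m n => (b.red, b.blue, b.top, b.bot))
    (fun b c h => by
      simp only [Prod.mk.injEq] at h
      exact TubeBoundary.ext h.1 h.2.1 h.2.2.1 h.2.2.2)

variable {D}

/-- The product `a_m ⊗ (⋯ ⊗ a_1)` of red legs: after a leg leaving the red arc to the left is bent
upwards, the uppermost leg is next to the arc. -/
def redProd : (m : ℕ) → (Fin m → Irr D) → D
  | 0, _ => 𝟙_ D
  | m + 1, a => redProd m (fun i => a i.succ) ⊗ (a 0).obj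

/-- The product `b_1 ⊗ (⋯ ⊗ b_n)` of blue legs: after a leg leaving the blue arc to the right is
bent upwards, the uppermost leg is next to the arc. -/
def blueProd : (n : ℕ) → (Fin n → Irr D) → D
  | 0, _ => 𝟙_ D
  | n + 1, b => (b 0).obj ⊗ blueProd n (fun i => b i.succ)

/-- The product of the red legs on a boundary circle. -/
def TubeBoundary.redObj {m n : ℕ} (o : TubeBoundary D m n) : D := redProd m o.red

/-- The product of the blue legs on a boundary circle. -/
def TubeBoundary.blueObj {m n : ℕ} (o : TubeBoundary D m n) : D := blueProd n o.blue

variable {m₀ m₁ m₂ n₀ n₁ n₂ : ℕ}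

/-- Tube string-nets with external labels `o`, internal labels `i`, a red arc running from `A` at
the bottom to `A'` at the top, and a blue arc running from `B` to `B'`. Diagrams are read upwards
and the legs are directed from the inside to the outside. The four factors are
* the lower vertical line: the outer edge splits off `A` to the left and `B` to the right;
* the red arc, absorbing the internal red legs and emitting the external ones;
* the blue arc, absorbing the internal blue legs and emitting the external ones;
* the upper vertical line: the inner edge absorbs `A'` from the left and `B'` from the right. -/
abbrev TubeDiagram (A A' B B' : D) (o : TubeBoundary D m₁ n₁) (i : TubeBoundary D m₀ n₀) :
    Type v :=
  (o.bot.obj ⟶ (A ⊗ i.bot.obj) ⊗ B) ⊗[ℂ]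
    ((A ⊗ i.redObj ⟶ o.redObj ⊗ A') ⊗[ℂ]
      ((i.blueObj ⊗ B ⟶ B' ⊗ o.blueObj) ⊗[ℂ]
        ((A' ⊗ i.top.obj) ⊗ B' ⟶ o.top.obj)))

/-- The span of the tube string-nets with simple edges and prescribed boundary labels. -/
abbrev TubeBlock (o : TubeBoundary D m₁ n₁) (i : TubeBoundary D m₀ n₀) : Type (max u v) :=
  DirectSum (TubeArcs D) fun k =>
    TubeDiagram k.redBot.obj k.redTop.obj k.blueBot.obj k.blueTop.obj o i

variable (D) in
/-- The tube space `T^{m₀,m₁;n₀,n₁}`: `m₀` red internal, `m₁` red external, `n₀` blue internal and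
`n₁` blue external legs. It is the direct sum of the blocks over all boundary labels. -/
abbrev TubeSpace (m₀ m₁ n₀ n₁ : ℕ) : Type (max u v) :=
  (o : TubeBoundary D m₁ n₁) → (i : TubeBoundary D m₀ n₀) → TubeBlock o i

/-! ### Stacking diagrams -/

/-- Rebracketing two nested pairs of vertical strands around `V`. -/
def nestIso (A A₂ V B₂ B : D) :
    ((A ⊗ A₂) ⊗ V) ⊗ (B₂ ⊗ B) ≅ (A ⊗ ((A₂ ⊗ V) ⊗ B₂)) ⊗ B :=
  (α_ _ _ _).symm ≪≫ whiskerRightIso (whiskerRightIso (α_ _ _ _) _ ≪≫ α_ _ _ _) _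

variable [MonoidalPreadditive D] [MonoidalLinear ℂ D]

/-- Stacking of the lower vertical lines. -/
def botStack (A A₂ B₂ B y v' v : D) :
    (y ⟶ (A ⊗ v') ⊗ B) →ₗ[ℂ] (v' ⟶ (A₂ ⊗ v) ⊗ B₂) →ₗ[ℂ]
      (y ⟶ ((A ⊗ A₂) ⊗ v) ⊗ (B₂ ⊗ B)) :=
  LinearMap.mk₂ ℂ (fun p p₂ => p ≫ ((A ◁ p₂) ▷ B) ≫ (nestIso A A₂ v B₂ B).inv)
    (by intros; simp) (by intros; simp) (by intros; simp) (by intros; simp)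

/-- Stacking of the upper vertical lines. -/
def topStack (A A₂ B₂ B x u' u : D) :
    ((A ⊗ u') ⊗ B ⟶ x) →ₗ[ℂ] ((A₂ ⊗ u) ⊗ B₂ ⟶ u') →ₗ[ℂ]
      (((A ⊗ A₂) ⊗ u) ⊗ (B₂ ⊗ B) ⟶ x) :=
  LinearMap.mk₂ ℂ (fun q q₂ => (nestIso A A₂ u B₂ B).hom ≫ ((A ◁ q₂) ▷ B) ≫ q)
    (by intros; simp) (by intros; simp) (by intros; simp) (by intros; simp)

/-- Stacking of the red arcs along the legs `C`; the outer arc is on the left. -/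
def redStack (A A' A₂ A₂' E C C₂ : D) :
    (A ⊗ C ⟶ E ⊗ A') →ₗ[ℂ] (A₂ ⊗ C₂ ⟶ C ⊗ A₂') →ₗ[ℂ]
      ((A ⊗ A₂) ⊗ C₂ ⟶ E ⊗ (A' ⊗ A₂')) :=
  LinearMap.mk₂ ℂ
    (fun r r₂ => (α_ _ _ _).hom ≫ (A ◁ r₂) ≫ (α_ _ _ _).inv ≫ (r ▷ A₂') ≫ (α_ _ _ _).hom)
    (by intros; simp) (by intros; simp) (by intros; simp) (by intros; simp)

/-- Stacking of the blue arcs along the legs `C`; the outer arc is on the right. -/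
def blueStack (B B' B₂ B₂' G C C₂ : D) :
    (C ⊗ B ⟶ B' ⊗ G) →ₗ[ℂ] (C₂ ⊗ B₂ ⟶ B₂' ⊗ C) →ₗ[ℂ]
      (C₂ ⊗ (B₂ ⊗ B) ⟶ (B₂' ⊗ B') ⊗ G) :=
  LinearMap.mk₂ ℂ
    (fun s s₂ => (α_ _ _ _).inv ≫ (s₂ ▷ B) ≫ (α_ _ _ _).hom ≫ (B₂' ◁ s) ≫ (α_ _ _ _).inv)
    (by intros; simp) (by intros; simp) (by intros; simp) (by intros; simp)

/-- Stacking of a tube diagram around another one, when the internal labels of the first are the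
external labels of the second. The two parallel red arcs are kept as one cable labelled by a
tensor product, and likewise the blue ones. -/
def diagramStack (A A' B B' A₂ A₂' B₂ B₂' : D) (o : TubeBoundary D m₂ n₂)
    (c : TubeBoundary D m₁ n₁) (i : TubeBoundary D m₀ n₀) :
    TubeDiagram A A' B B' o c →ₗ[ℂ] TubeDiagram A₂ A₂' B₂ B₂' c i →ₗ[ℂ]
      TubeDiagram (A ⊗ A₂) (A' ⊗ A₂') (B₂ ⊗ B) (B₂' ⊗ B') o i :=
  TensorProduct.map₂ (botStack A A₂ B₂ B _ _ _)
    (TensorProduct.map₂ (redStack A A' A₂ A₂' _ _ _)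
      (TensorProduct.map₂ (blueStack B B' B₂ B₂' _ _ _) (topStack A' A₂' B₂' B' _ _ _)))

/-- Inserting morphisms on the two ends of both arcs of a tube diagram. -/
def cutArcs {A A' B B' P P' Q Q' : D} (o : TubeBoundary D m₁ n₁) (i : TubeBoundary D m₀ n₀)
    (f : A ⟶ P) (f' : P ⟶ A) (g : A' ⟶ P') (g' : P' ⟶ A')
    (h : B ⟶ Q) (h' : Q ⟶ B) (k : B' ⟶ Q') (k' : Q' ⟶ B') :
    TubeDiagram A A' B B' o i →ₗ[ℂ] TubeDiagram P P' Q Q' o i :=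
  TensorProduct.map (Linear.rightComp ℂ _ ((f ▷ i.bot.obj) ⊗ₘ h))
    (TensorProduct.map
      (Linear.leftComp ℂ _ (f' ▷ i.redObj) ∘ₗ Linear.rightComp ℂ _ (o.redObj ◁ g))
      (TensorProduct.map
        (Linear.leftComp ℂ _ (i.blueObj ◁ h') ∘ₗ Linear.rightComp ℂ _ (k ▷ o.blueObj))
        (Linear.leftComp ℂ _ ((g' ▷ i.top.obj) ⊗ₘ k'))))

variable [RigidCategory D] [IsMultifusion D]

/-- The parallel move: the identity of each of the four arc segments is resolved as a sum over
simple objects. This writes a diagram with arbitrary objects on its arcs as a combination of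
diagrams with simple edges. -/
def parallelMove (A A' B B' : D) (o : TubeBoundary D m₁ n₁) (i : TubeBoundary D m₀ n₀) :
    TubeDiagram A A' B B' o i →ₗ[ℂ] TubeBlock o i :=
  let a := simpleDecomposition A
  let a' := simpleDecomposition A'
  let b := simpleDecomposition B
  let b' := simpleDecomposition B'
  ∑ j : Fin a.n, ∑ j' : Fin a'.n, ∑ l : Fin b.n, ∑ l' : Fin b'.n,
    DirectSum.lof ℂ (TubeArcs D)
        (fun k => TubeDiagram k.redBot.obj k.redTop.obj k.blueBot.obj k.blueTop.obj o i)
        ⟨a.label j, a'.label j', b.label l, b'.label l'⟩ ∘ₗ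
      cutArcs o i (a.proj j) (a.inj j) (a'.proj j') (a'.inj j')
        (b.proj l) (b.inj l) (b'.proj l') (b'.inj l')

/-- Stacking of combinations of simple-edged diagrams with matching labels in the middle. -/
def blockStack (o : TubeBoundary D m₂ n₂) (c : TubeBoundary D m₁ n₁) (i : TubeBoundary D m₀ n₀) :
    TubeBlock o c →ₗ[ℂ] TubeBlock c i →ₗ[ℂ] TubeBlock o i :=
  DirectSum.toModule ℂ _ _ fun k =>
    (DirectSum.toModule ℂ _ _ fun k₂ =>
      ((diagramStack k.redBot.obj k.redTop.obj k.blueBot.obj k.blueTop.obj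
        k₂.redBot.obj k₂.redTop.obj k₂.blueBot.obj k₂.blueTop.obj o c i).compr₂
          (parallelMove _ _ _ _ o i)).flip).flip

/-- Stacking `X ∈ T^{m₁,m₂;n₁,n₂}` around `Y ∈ T^{m₀,m₁;n₀,n₁}`. Diagrams compose only if all the
labels on the common circle agree. -/
def tubeStack :
    TubeSpace D m₁ m₂ n₁ n₂ →ₗ[ℂ] TubeSpace D m₀ m₁ n₀ n₁ →ₗ[ℂ] TubeSpace D m₀ m₂ n₀ n₂ :=
  LinearMap.mk₂ ℂ (fun X Y o i => ∑ c, blockStack o c i (X o c) (Y c i))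
    (by intros; ext1; ext1; simp [Finset.sum_add_distrib])
    (by intros; ext1; ext1; simp [Finset.smul_sum])
    (by intros; ext1; ext1; simp [Finset.sum_add_distrib])
    (by intros; ext1; ext1; simp [Finset.smul_sum])

/-- The diagram with both arcs labelled by the tensor unit and all the other edges running straight
from the inside to the outside. -/
def straightDiagram {m n : ℕ} (o : TubeBoundary D m n) :
    TubeDiagram (𝟙_ D) (𝟙_ D) (𝟙_ D) (𝟙_ D) o o :=
  ((λ_ o.bot.obj).inv ≫ (ρ_ _).inv) ⊗ₜ
    (((λ_ o.redObj).hom ≫ (ρ_ o.redObj).inv) ⊗ₜ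
      (((ρ_ o.blueObj).hom ≫ (λ_ o.blueObj).inv) ⊗ₜ
        ((ρ_ _).hom ≫ (λ_ o.top.obj).hom)))

variable (D) in
/-- The sum of the straight diagrams over all boundary labels. -/
def tubeOne (m n : ℕ) : TubeSpace D m m n n :=
  fun o => Pi.single o (parallelMove _ _ _ _ o o (straightDiagram o))

/-! ### The bulk tube algebra -/

/-- Tubes without legs whose red arc is a single edge `A` and whose blue arc is a single edge
`B`; `o` and `i` are the top and bottom labels outside and inside. -/
abbrev BulkDiagram (A B : D) (o i : Irr D × Irr D) : Type v :=
  (o.2.obj ⟶ (A ⊗ i.2.obj) ⊗ B) ⊗[ℂ] ((A ⊗ i.1.obj) ⊗ B ⟶ o.1.obj)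

/-- The span of the bulk tubes with simple edges and prescribed boundary labels. -/
abbrev BulkBlock (o i : Irr D × Irr D) : Type (max u v) :=
  DirectSum (Irr D × Irr D) fun k => BulkDiagram k.1.obj k.2.obj o i

variable (D) in
/-- The vector space underlying the bulk tube algebra. -/
abbrev BulkTube : Type (max u v) := (o : Irr D × Irr D) → (i : Irr D × Irr D) → BulkBlock o i

/-- The parallel move for bulk tubes. -/
def bulkParallelMove (A B : D) (o i : Irr D × Irr D) : BulkDiagram A B o i →ₗ[ℂ] BulkBlock o i :=
  let a := simpleDecomposition A
  let b := simpleDecomposition B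
  ∑ j : Fin a.n, ∑ l : Fin b.n,
    DirectSum.lof ℂ (Irr D × Irr D) (fun k => BulkDiagram k.1.obj k.2.obj o i)
        ⟨a.label j, b.label l⟩ ∘ₗ
      TensorProduct.map (Linear.rightComp ℂ _ ((a.proj j ▷ i.2.obj) ⊗ₘ b.proj l))
        (Linear.leftComp ℂ _ ((a.inj j ▷ i.1.obj) ⊗ₘ b.inj l))

/-- Stacking of bulk tubes with matching labels in the middle. -/
def bulkBlockStack (o c i : Irr D × Irr D) :
    BulkBlock o c →ₗ[ℂ] BulkBlock c i →ₗ[ℂ] BulkBlock o i :=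
  DirectSum.toModule ℂ _ _ fun k =>
    (DirectSum.toModule ℂ _ _ fun k₂ =>
      ((TensorProduct.map₂ (botStack k.1.obj k₂.1.obj k₂.2.obj k.2.obj _ _ _)
        (topStack k.1.obj k₂.1.obj k₂.2.obj k.2.obj _ _ _)).compr₂
          (bulkParallelMove _ _ o i)).flip).flip

/-- The multiplication of the bulk tube algebra. -/
def bulkMul (X Y : BulkTube D) : BulkTube D :=
  fun o i => ∑ c, bulkBlockStack o c i (X o c) (Y c i)

variable (D) in
/-- The unit of the bulk tube algebra. -/
def bulkOne : BulkTube D :=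
  fun o => Pi.single o (bulkParallelMove (𝟙_ D) (𝟙_ D) o o
    (((λ_ o.2.obj).inv ≫ (ρ_ _).inv) ⊗ₜ ((ρ_ _).hom ≫ (λ_ o.1.obj).hom)))

/-- A bulk tube regarded as an element of `T^{0,0;0,0}`: the red edge `A` is a red arc without
legs running from `A` to `A`, and likewise for the blue edge. -/
def bulkToTube : BulkTube D →ₗ[ℂ] TubeSpace D 0 0 0 0 :=
  LinearMap.pi fun o => LinearMap.pi fun i =>
    (DirectSum.toModule ℂ (Irr D × Irr D) (TubeBlock o i) fun k =>
      DirectSum.lof ℂ (TubeArcs D)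
          (fun k => TubeDiagram k.redBot.obj k.redTop.obj k.blueBot.obj k.blueTop.obj o i)
          ⟨k.1, k.1, k.2, k.2⟩ ∘ₗ
        TensorProduct.map LinearMap.id
          (TensorProduct.mk ℂ (k.1.obj ⊗ i.redObj ⟶ o.redObj ⊗ k.1.obj) _
              ((ρ_ k.1.obj).hom ≫ (λ_ k.1.obj).inv) ∘ₗ
            TensorProduct.mk ℂ (i.blueObj ⊗ k.2.obj ⟶ k.2.obj ⊗ o.blueObj) _
              ((λ_ k.2.obj).hom ≫ (ρ_ k.2.obj).inv))) ∘ₗ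
    LinearMap.proj (i.top, i.bot) ∘ₗ LinearMap.proj (o.top, o.bot)

end

/-! ### Algebras and bimodules -/

section

variable (D : Type u) [Category.{v} D] [Abelian D] [Linear ℂ D] [MonoidalCategory D]
  [MonoidalPreadditive D] [MonoidalLinear ℂ D] [RigidCategory D] [IsMultifusion D]

/-- Stacking of tubes is associative and has the tubes `tubeOne` as units. -/
structure TubeLaws : Prop where
  assoc : ∀ {m₀ m₁ m₂ m₃ n₀ n₁ n₂ n₃ : ℕ} (X : TubeSpace D m₂ m₃ n₂ n₃)
    (Y : TubeSpace D m₁ m₂ n₁ n₂) (Z : TubeSpace D m₀ m₁ n₀ n₁),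
    tubeStack (tubeStack X Y) Z = tubeStack X (tubeStack Y Z)
  one_stack : ∀ {m₀ m₁ n₀ n₁ : ℕ} (X : TubeSpace D m₀ m₁ n₀ n₁),
    tubeStack (tubeOne D m₁ n₁) X = X
  stack_one : ∀ {m₀ m₁ n₀ n₁ : ℕ} (X : TubeSpace D m₀ m₁ n₀ n₁),
    tubeStack X (tubeOne D m₀ n₀) = X

variable {D}

/-- `T^{m,m;n,n}` as an algebra under stacking. -/
def TubeAlg (_ : TubeLaws D) (m n : ℕ) : Type (max u v) := TubeSpace D m m n n

/-- `T^{m,s;n,t}` as a left module over `T^{s,s;t,t}` and a right module over `T^{m,m;n,n}`, by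
stacking on the outside and on the inside. -/
def TubeBimod (_ : TubeLaws D) (m s n t : ℕ) : Type (max u v) := TubeSpace D m s n t

variable (h : TubeLaws D) (m s n t : ℕ)

instance : AddCommGroup (TubeAlg h m n) := inferInstanceAs (AddCommGroup (TubeSpace D m m n n))
instance : Module ℂ (TubeAlg h m n) := inferInstanceAs (Module ℂ (TubeSpace D m m n n))
instance : AddCommGroup (TubeBimod h m s n t) :=
  inferInstanceAs (AddCommGroup (TubeSpace D m s n t))
instance : Module ℂ (TubeBimod h m s n t) := inferInstanceAs (Module ℂ (TubeSpace D m s n t))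

/-- Stacking as an operation on the bimodules and algebras. -/
abbrev stack {m s p n t q : ℕ} (X : TubeSpace D s p t q) (Y : TubeSpace D m s n t) :
    TubeSpace D m p n q := tubeStack X Y

instance : Ring (TubeAlg h m n) :=
  { (inferInstance : AddCommGroup (TubeAlg h m n)) with
    mul := fun X Y => stack X Y
    one := tubeOne D m n
    mul_assoc := fun X Y Z => h.assoc X Y Z
    one_mul := fun X => h.one_stack X
    mul_one := fun X => h.stack_one X
    left_distrib := fun X Y Z => map_add (tubeStack (D := D) X) Y Z
    right_distrib := fun X Y Z => LinearMap.map_add₂ (tubeStack (D := D)) X Y Z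
    zero_mul := fun X => LinearMap.map_zero₂ (tubeStack (D := D)) X
    mul_zero := fun X => map_zero (tubeStack (D := D) X) }

instance : Algebra ℂ (TubeAlg h m n) :=
  Algebra.ofModule (fun c X Y => LinearMap.map_smul₂ (tubeStack (D := D)) c X Y)
    (fun c X Y => map_smul (tubeStack (D := D) X) c Y)

instance : Module (TubeAlg h s t) (TubeBimod h m s n t) where
  smul a X := stack a X
  one_smul X := h.one_stack X
  mul_smul a b X := h.assoc a b X
  smul_zero a := map_zero (tubeStack (D := D) a)
  smul_add a X Y := map_add (tubeStack (D := D) a) X Y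
  add_smul a b X := LinearMap.map_add₂ (tubeStack (D := D)) a b X
  zero_smul X := LinearMap.map_zero₂ (tubeStack (D := D)) X

instance : Module (TubeAlg h m n)ᵐᵒᵖ (TubeBimod h m s n t) where
  smul a X := stack X a.unop
  one_smul X := h.stack_one X
  mul_smul a b X := (h.assoc X b.unop a.unop).symm
  smul_zero a := LinearMap.map_zero₂ (tubeStack (D := D)) a.unop
  smul_add a X Y := LinearMap.map_add₂ (tubeStack (D := D)) X Y a.unop
  add_smul a b X := map_add (tubeStack (D := D) X) a.unop b.unop
  zero_smul X := map_zero (tubeStack (D := D) X)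

end

/-- The tensor product `M ⊗_A N` of a right module and a left module over a (not necessarily
commutative) `k`-algebra `A`. -/
abbrev BalancedTensor (k A M N : Type*) [CommRing k] [Ring A] [Algebra k A]
    [AddCommGroup M] [Module k M] [Module Aᵐᵒᵖ M] [AddCommGroup N] [Module k N] [Module A N] :
    Type _ :=
  (M ⊗[k] N) ⧸ Submodule.span k
    {z : M ⊗[k] N | ∃ (x : M) (a : A) (y : N),
      z = (MulOpposite.op a • x) ⊗ₜ[k] y - x ⊗ₜ[k] (a • y)}

/-- The class of `x ⊗ y` in `M ⊗_A N`. -/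
def BalancedTensor.tmul (k A : Type*) {M N : Type*} [CommRing k] [Ring A] [Algebra k A]
    [AddCommGroup M] [Module k M] [Module Aᵐᵒᵖ M] [AddCommGroup N] [Module k N] [Module A N]
    (x : M) (y : N) : BalancedTensor k A M N :=
  Submodule.Quotient.mk (x ⊗ₜ[k] y)

section

variable {D : Type u} [Category.{v} D] [Abelian D] [Linear ℂ D] [MonoidalCategory D]
  [MonoidalPreadditive D] [MonoidalLinear ℂ D] [RigidCategory D] [IsMultifusion D]

/-- Stacking induces an isomorphism
`T^{m,s;n,t} ⊗_{T^{m,m;n,n}} T^{s,m;t,n} ≅ T^{s,s;t,t}` of `T^{s,s;t,t}`-bimodules. The two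
bimodule structures on the left are determined by their values on the classes of `X ⊗ Y`. -/
def StackingIsBimoduleIso (h : TubeLaws D) (m s n t : ℕ) : Prop :=
  ∃ e : BalancedTensor ℂ (TubeAlg h m n) (TubeBimod h m s n t) (TubeBimod h s m t n) ≃ₗ[ℂ]
      TubeAlg h s t,
    (∀ (X : TubeBimod h m s n t) (Y : TubeBimod h s m t n),
      e (.tmul ℂ (TubeAlg h m n) X Y) = stack X Y) ∧
    (∀ (a : TubeAlg h s t) (X : TubeBimod h m s n t) (Y : TubeBimod h s m t n),
      e (.tmul ℂ (TubeAlg h m n) (a • X) Y) = a * e (.tmul ℂ (TubeAlg h m n) X Y)) ∧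
    (∀ (a : TubeAlg h s t) (X : TubeBimod h m s n t) (Y : TubeBimod h s m t n),
      e (.tmul ℂ (TubeAlg h m n) X (MulOpposite.op a • Y)) =
        e (.tmul ℂ (TubeAlg h m n) X Y) * a)

end

end

/-!
Sliding a morphism along an arc, from one of its ends to the other, does not change the tube that
its parallel move represents: tubes with arbitrary arcs form a coend, which the diagrams with
simple arcs already compute. A map out of the tube space may therefore be evaluated on arbitrary
arcs as soon as it is insensitive to such slides (`IsDinatural`). Stacking is, and on arbitrary arcs
it only tensors the arcs together, so associativity and unitality reduce to naturality and coherence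
of the associators and unitors.

For the Morita equivalence it is enough that both pairings hit the unit. The tensor unit is a direct
summand of a sum of products of any number of legs, and the straight tube on a circle factors
through circles with these legs: the legs of the given circle are absorbed into its upper vertical
edge, cross the middle circle there, and are bent back out by a coevaluation; the zigzag identities
straighten the result.

A legless arc is, up to unitors, a morphism between its two end segments, and sliding it into the
upper vertical edge turns a legless tube into a bulk tube.
-/

noncomputable section

/-! ### Simple objects -/

section

variable {C : Type u} [Category.{v} C]

namespace Irr

section

variable [Limits.HasZeroMorphisms C]

instance (a : Irr C) : Simple a.obj :=
  (Quotient.out (s := simpleSetoid C) a).2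

theorem eq_of_iso {a b : Irr C} (e : a.obj ≅ b.obj) : a = b := by
  rw [← Quotient.out_eq (s := simpleSetoid C) a, ← Quotient.out_eq (s := simpleSetoid C) b]
  exact Quotient.sound (s := simpleSetoid C) ⟨e⟩

end

variable [Preadditive C]

theorem hom_eq_zero_of_ne [Limits.HasKernels C] {a b : Irr C} (h : a ≠ b) (f : a.obj ⟶ b.obj) :
    f = 0 := by
  by_contra hf
  have := isIso_of_hom_simple hf
  exact h (eq_of_iso (asIso f))

@[elab_as_elim]
theorem hom_induction [Limits.HasKernels C] (k : Type*) [Field k] [IsAlgClosed k] [Linear k C]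
    [∀ a : Irr C, FiniteDimensional k (a.obj ⟶ a.obj)]
    {motive : ∀ a b : Irr C, (a.obj ⟶ b.obj) → Prop} (zero : ∀ a b, motive a b 0)
    (smul_id : ∀ (a : Irr C) (c : k), motive a a (c • 𝟙 a.obj)) {a b : Irr C}
    (f : a.obj ⟶ b.obj) : motive a b f := by
  by_cases h : a = b
  · subst h
    obtain ⟨c, rfl⟩ := endomorphism_simple_eq_smul_id k f
    exact smul_id a c
  · exact hom_eq_zero_of_ne h f ▸ zero a b

end Irr

/-! ### Resolutions of the identity -/

/-- A resolution of the identity of `A` through the objects `ob i`: the index set may repeat or omit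
labels, and no orthogonality is required. -/
structure Resolution [Preadditive C] {I : Type*} (ob : I → C) (A : C) where
  /-- the set over which the resolution sums -/
  ι : Type
  [fintype : Fintype ι]
  /-- the object through which each term factors -/
  label : ι → I
  /-- the first half of each term -/
  proj : ∀ j, A ⟶ ob (label j)
  /-- the second half of each term -/
  inj : ∀ j, ob (label j) ⟶ A
  total : ∑ j, proj j ≫ inj j = 𝟙 A

namespace Resolution

attribute [instance] Resolution.fintype

variable [Preadditive C] {I J : Type*} {ob : I → C} {ob' : J → C} {A B : C}

/-- The resolution with a single term. -/
def refl (ob : I → C) (i : I) : Resolution ob (ob i) where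
  ι := Unit
  label _ := i
  proj _ := 𝟙 _
  inj _ := 𝟙 _
  total := by simp

/-- The resolution of an isomorphic object. -/
def ofIso (R : Resolution ob A) (e : A ≅ B) : Resolution ob B where
  ι := R.ι
  label := R.label
  proj j := e.inv ≫ R.proj j
  inj j := R.inj j ≫ e.hom
  total := by
    simp only [Category.assoc, ← Preadditive.comp_sum]
    simp only [← Category.assoc, ← Preadditive.sum_comp, R.total, Category.comp_id, e.inv_hom_id]

/-- The resolution through a larger family of objects. -/
def relabel (m : J → I) (R : Resolution (fun x => ob (m x)) A) : Resolution ob A where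
  ι := R.ι
  label j := m (R.label j)
  proj := R.proj
  inj := R.inj
  total := R.total

/-- The tensor product of two resolutions. -/
def tensor [MonoidalCategory C] [MonoidalPreadditive C] (R : Resolution ob A)
    (S : Resolution ob' B) :
    Resolution (fun x : I × J => ob x.1 ⊗ ob' x.2) (A ⊗ B) where
  ι := R.ι × S.ι
  label x := (R.label x.1, S.label x.2)
  proj x := R.proj x.1 ⊗ₘ S.proj x.2
  inj x := R.inj x.1 ⊗ₘ S.inj x.2
  total := by
    simp only [tensorHom_comp_tensorHom, Fintype.sum_prod_type, ← tensor_sum, tensorHom_id,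
      ← sum_whiskerRight, total, id_whiskerRight]

theorem sum_flank [MonoidalCategory C] [MonoidalPreadditive C] (R : Resolution ob A)
    (S : Resolution ob' B) (V : C) :
    ∑ x : R.ι × S.ι, (R.proj x.1 ▷ V ⊗ₘ S.proj x.2) ≫ (R.inj x.1 ▷ V ⊗ₘ S.inj x.2) =
      𝟙 ((A ⊗ V) ⊗ B) := by
  simp only [tensorHom_comp_tensorHom, ← comp_whiskerRight, Fintype.sum_prod_type, ← tensor_sum,
    tensorHom_id, ← sum_whiskerRight, total, id_whiskerRight]

end Resolution

end

section

variable {D : Type u} [Category.{v} D] [Abelian D] [Linear ℂ D] [MonoidalCategory D]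
  [MonoidalPreadditive D] [MonoidalLinear ℂ D] [RigidCategory D] [IsMultifusion D]

/-- The resolution of the identity through the simple summands of the chosen decomposition. -/
def simpleResolution (A : D) : Resolution Irr.obj A where
  ι := Fin (simpleDecomposition A).n
  label := (simpleDecomposition A).label
  proj := (simpleDecomposition A).proj
  inj := (simpleDecomposition A).inj
  total := (simpleDecomposition A).total

instance (X Y : D) : FiniteDimensional ℂ (X ⟶ Y) := IsMultifusion.finiteDimensional X Y

end

/-! ### Tubes with arbitrary arcs -/

theorem tensorHom_smul {k C : Type*} [Semiring k] [Category* C] [Preadditive C] [Linear k C]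
    [MonoidalCategory C] [MonoidalPreadditive C] [MonoidalLinear k C] {X Y Z W : C} (c : k)
    (f : X ⟶ Y) (g : Z ⟶ W) : (f ⊗ₘ (c • g)) = c • (f ⊗ₘ g) := by
  simp only [MonoidalCategory.tensorHom_def, MonoidalLinear.whiskerLeft_smul, Linear.comp_smul]

section

variable {D : Type u} [Category.{v} D] [Abelian D] [Linear ℂ D] [MonoidalCategory D]
  {m₀ m₁ n₀ n₁ : ℕ} {o : TubeBoundary D m₁ n₁} {i : TubeBoundary D m₀ n₀}

/-- The tube diagram with lower vertex `p`, red arc `r`, blue arc `s` and upper vertex `q`. -/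
abbrev tubeDiagram {A A' B B' : D} (p : o.bot.obj ⟶ (A ⊗ i.bot.obj) ⊗ B)
    (r : A ⊗ i.redObj ⟶ o.redObj ⊗ A') (s : i.blueObj ⊗ B ⟶ B' ⊗ o.blueObj)
    (q : (A' ⊗ i.top.obj) ⊗ B' ⟶ o.top.obj) : TubeDiagram A A' B B' o i :=
  p ⊗ₜ (r ⊗ₜ (s ⊗ₜ q))

theorem tubeDiagram_sum_bot {A A' B B' : D} {ι : Type*} (t : Finset ι)
    (p : ι → (o.bot.obj ⟶ (A ⊗ i.bot.obj) ⊗ B)) (r : A ⊗ i.redObj ⟶ o.redObj ⊗ A')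
    (s : i.blueObj ⊗ B ⟶ B' ⊗ o.blueObj) (q : (A' ⊗ i.top.obj) ⊗ B' ⟶ o.top.obj) :
    tubeDiagram (∑ j ∈ t, p j) r s q = ∑ j ∈ t, tubeDiagram (p j) r s q :=
  sum_tmul ..

theorem tubeDiagram_sum_top {A A' B B' : D} {ι : Type*} (t : Finset ι)
    (p : o.bot.obj ⟶ (A ⊗ i.bot.obj) ⊗ B) (r : A ⊗ i.redObj ⟶ o.redObj ⊗ A')
    (s : i.blueObj ⊗ B ⟶ B' ⊗ o.blueObj) (q : ι → ((A' ⊗ i.top.obj) ⊗ B' ⟶ o.top.obj)) :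
    tubeDiagram p r s (∑ j ∈ t, q j) = ∑ j ∈ t, tubeDiagram p r s (q j) := by
  simp only [tubeDiagram, tmul_sum]

/-- The inclusion of the tube diagrams with simple arcs `k` into the span of all of them. -/
def TubeBlock.of (k : TubeArcs D) :
    TubeDiagram k.redBot.obj k.redTop.obj k.blueBot.obj k.blueTop.obj o i →ₗ[ℂ] TubeBlock o i :=
  DirectSum.lof ℂ (TubeArcs D)
    (fun k => TubeDiagram k.redBot.obj k.redTop.obj k.blueBot.obj k.blueTop.obj o i) k

/-- Families of linear maps on tube diagrams, with arcs labelled by the objects `ob x`, that do not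
see where a morphism between such objects is inserted: it may sit at the vertex or on the arc. -/
structure IsDinatural {I W : Type*} [AddCommGroup W] [Module ℂ W] (ob : I → D)
    (Φ : ∀ a a' b b' : I, TubeDiagram (ob a) (ob a') (ob b) (ob b') o i →ₗ[ℂ] W) : Prop where
  slide_bot : ∀ {a a' b b' x y : I} (f : ob a ⟶ ob x) (g : ob b ⟶ ob y)
    (p : o.bot.obj ⟶ (ob a ⊗ i.bot.obj) ⊗ ob b) (r : ob x ⊗ i.redObj ⟶ o.redObj ⊗ ob a')
    (s : i.blueObj ⊗ ob y ⟶ ob b' ⊗ o.blueObj) (q : (ob a' ⊗ i.top.obj) ⊗ ob b' ⟶ o.top.obj),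
    Φ x a' y b' (tubeDiagram (p ≫ (f ▷ i.bot.obj ⊗ₘ g)) r s q) =
      Φ a a' b b' (tubeDiagram p (f ▷ i.redObj ≫ r) (i.blueObj ◁ g ≫ s) q)
  slide_top : ∀ {a a' b b' x y : I} (f : ob a' ⟶ ob x) (g : ob b' ⟶ ob y)
    (p : o.bot.obj ⟶ (ob a ⊗ i.bot.obj) ⊗ ob b) (r : ob a ⊗ i.redObj ⟶ o.redObj ⊗ ob a')
    (s : i.blueObj ⊗ ob b ⟶ ob b' ⊗ o.blueObj) (q : (ob x ⊗ i.top.obj) ⊗ ob y ⟶ o.top.obj),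
    Φ a x b y (tubeDiagram p (r ≫ o.redObj ◁ f) (s ≫ g ▷ o.blueObj) q) =
      Φ a a' b b' (tubeDiagram p r s ((f ▷ i.top.obj ⊗ₘ g) ≫ q))

@[elab_as_elim]
theorem TubeDiagram.induction {A A' B B' : D} {motive : TubeDiagram A A' B B' o i → Prop}
    (zero : motive 0) (add : ∀ X Y, motive X → motive Y → motive (X + Y))
    (pure : ∀ p r s q, motive (tubeDiagram p r s q)) (X : TubeDiagram A A' B B' o i) :
    motive X := by
  refine TensorProduct.induction_on X zero (fun p t => ?_) add
  refine TensorProduct.induction_on t (by rwa [tmul_zero]) (fun r t => ?_)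
    (fun _ _ h₁ h₂ => by rw [tmul_add]; exact add _ _ h₁ h₂)
  refine TensorProduct.induction_on t (by rwa [tmul_zero, tmul_zero]) (fun s q => pure p r s q)
    (fun _ _ h₁ h₂ => by rw [tmul_add, tmul_add]; exact add _ _ h₁ h₂)

@[elab_as_elim]
theorem TubeBlock.induction {motive : TubeBlock o i → Prop} (zero : motive 0)
    (add : ∀ X Y, motive X → motive Y → motive (X + Y))
    (of : ∀ k p r s q, motive (TubeBlock.of k (tubeDiagram p r s q))) (X : TubeBlock o i) :
    motive X := by
  refine DirectSum.induction_on X zero (fun k t => ?_) add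
  induction t using TubeDiagram.induction with
  | zero => exact (map_zero (TubeBlock.of k)).symm ▸ zero
  | add X Y hX hY => exact (map_add (TubeBlock.of k) X Y).symm ▸ add _ _ hX hY
  | pure p r s q => exact of k p r s q

namespace IsDinatural

variable {I J W : Type*} [AddCommGroup W] [Module ℂ W] {ob : I → D}
  {Φ : ∀ a a' b b' : I, TubeDiagram (ob a) (ob a') (ob b) (ob b') o i →ₗ[ℂ] W}

theorem congr (hΦ : IsDinatural ob Φ) {a a' b b' x x' y y' : I}
    (f : ob a ⟶ ob x) (f' : ob a' ⟶ ob x') (g : ob b ⟶ ob y) (g' : ob b' ⟶ ob y')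
    {p : o.bot.obj ⟶ (ob a ⊗ i.bot.obj) ⊗ ob b} {r : ob a ⊗ i.redObj ⟶ o.redObj ⊗ ob a'}
    {s : i.blueObj ⊗ ob b ⟶ ob b' ⊗ o.blueObj} {q : (ob a' ⊗ i.top.obj) ⊗ ob b' ⟶ o.top.obj}
    {p₁ : o.bot.obj ⟶ (ob x ⊗ i.bot.obj) ⊗ ob y} {r₁ : ob x ⊗ i.redObj ⟶ o.redObj ⊗ ob x'}
    {s₁ : i.blueObj ⊗ ob y ⟶ ob y' ⊗ o.blueObj} {q₁ : (ob x' ⊗ i.top.obj) ⊗ ob y' ⟶ o.top.obj}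
    (hp : p ≫ (f ▷ i.bot.obj ⊗ₘ g) = p₁) (hr : r ≫ o.redObj ◁ f' = f ▷ i.redObj ≫ r₁)
    (hs : s ≫ g' ▷ o.blueObj = i.blueObj ◁ g ≫ s₁) (hq : q = (f' ▷ i.top.obj ⊗ₘ g') ≫ q₁) :
    Φ a a' b b' (tubeDiagram p r s q) = Φ x x' y y' (tubeDiagram p₁ r₁ s₁ q₁) := by
  rw [hq, ← hΦ.slide_top, hr, hs, ← hΦ.slide_bot, hp]

variable [MonoidalPreadditive D] {A A' B B' P Q : D}

theorem sum_slide_bot (hΦ : IsDinatural ob Φ) (R : Resolution ob A) (R' : Resolution ob P)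
    (S : Resolution ob B) (S' : Resolution ob Q) (f : A ⟶ P) (g : B ⟶ Q) {a' b' : I}
    (p : o.bot.obj ⟶ (A ⊗ i.bot.obj) ⊗ B) (r : P ⊗ i.redObj ⟶ o.redObj ⊗ ob a')
    (s : i.blueObj ⊗ Q ⟶ ob b' ⊗ o.blueObj) (q : (ob a' ⊗ i.top.obj) ⊗ ob b' ⟶ o.top.obj) :
    ∑ x : R'.ι × S'.ι, Φ (R'.label x.1) a' (S'.label x.2) b'
        (tubeDiagram (p ≫ (f ▷ i.bot.obj ⊗ₘ g) ≫ (R'.proj x.1 ▷ i.bot.obj ⊗ₘ S'.proj x.2))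
          (R'.inj x.1 ▷ i.redObj ≫ r) (i.blueObj ◁ S'.inj x.2 ≫ s) q) =
      ∑ y : R.ι × S.ι, Φ (R.label y.1) a' (S.label y.2) b'
        (tubeDiagram (p ≫ (R.proj y.1 ▷ i.bot.obj ⊗ₘ S.proj y.2))
          (R.inj y.1 ▷ i.redObj ≫ f ▷ i.redObj ≫ r)
          (i.blueObj ◁ S.inj y.2 ≫ i.blueObj ◁ g ≫ s) q) := by
  have resolve_source (x : R'.ι × S'.ι) :
      p ≫ (f ▷ i.bot.obj ⊗ₘ g) ≫ (R'.proj x.1 ▷ i.bot.obj ⊗ₘ S'.proj x.2) =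
        ∑ y : R.ι × S.ι, (p ≫ (R.proj y.1 ▷ i.bot.obj ⊗ₘ S.proj y.2)) ≫
          ((R.inj y.1 ≫ f ≫ R'.proj x.1) ▷ i.bot.obj ⊗ₘ (S.inj y.2 ≫ g ≫ S'.proj x.2)) := by
    rw [← Category.id_comp (f ▷ i.bot.obj ⊗ₘ g), ← R.sum_flank S]
    simp only [Preadditive.sum_comp, Preadditive.comp_sum, comp_whiskerRight,
      ← tensorHom_comp_tensorHom, Category.assoc]
  have resolve_target (y : R.ι × S.ι) :
      ∑ x : R'.ι × S'.ι, tubeDiagram (p ≫ (R.proj y.1 ▷ i.bot.obj ⊗ₘ S.proj y.2))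
          ((R.inj y.1 ≫ f ≫ R'.proj x.1) ▷ i.redObj ≫ R'.inj x.1 ▷ i.redObj ≫ r)
          (i.blueObj ◁ (S.inj y.2 ≫ g ≫ S'.proj x.2) ≫ i.blueObj ◁ S'.inj x.2 ≫ s) q =
        tubeDiagram (p ≫ (R.proj y.1 ▷ i.bot.obj ⊗ₘ S.proj y.2))
          (R.inj y.1 ▷ i.redObj ≫ f ▷ i.redObj ≫ r)
          (i.blueObj ◁ S.inj y.2 ≫ i.blueObj ◁ g ≫ s) q := by
    simp only [tubeDiagram, Fintype.sum_prod_type, ← tmul_sum, ← sum_tmul,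
      ← comp_whiskerRight_assoc, ← whiskerLeft_comp_assoc, Category.assoc, ← Preadditive.sum_comp,
      ← Preadditive.comp_sum, ← whiskerLeft_sum, ← sum_whiskerRight, R'.total, S'.total,
      Category.comp_id]
  simp only [resolve_source, tubeDiagram_sum_bot, map_sum]
  rw [Finset.sum_comm]
  refine Finset.sum_congr rfl fun y _ => ?_
  rw [← resolve_target, map_sum]
  exact Finset.sum_congr rfl fun x _ => hΦ.slide_bot ..

theorem sum_slide_top (hΦ : IsDinatural ob Φ) (R : Resolution ob A') (R' : Resolution ob P)
    (S : Resolution ob B') (S' : Resolution ob Q) (f : A' ⟶ P) (g : B' ⟶ Q) {a b : I}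
    (p : o.bot.obj ⟶ (ob a ⊗ i.bot.obj) ⊗ ob b) (r : ob a ⊗ i.redObj ⟶ o.redObj ⊗ A')
    (s : i.blueObj ⊗ ob b ⟶ B' ⊗ o.blueObj) (q : (P ⊗ i.top.obj) ⊗ Q ⟶ o.top.obj) :
    ∑ x : R'.ι × S'.ι, Φ a (R'.label x.1) b (S'.label x.2)
        (tubeDiagram p (r ≫ o.redObj ◁ f ≫ o.redObj ◁ R'.proj x.1)
          (s ≫ g ▷ o.blueObj ≫ S'.proj x.2 ▷ o.blueObj)
          ((R'.inj x.1 ▷ i.top.obj ⊗ₘ S'.inj x.2) ≫ q)) =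
      ∑ y : R.ι × S.ι, Φ a (R.label y.1) b (S.label y.2)
        (tubeDiagram p (r ≫ o.redObj ◁ R.proj y.1) (s ≫ S.proj y.2 ▷ o.blueObj)
          ((R.inj y.1 ▷ i.top.obj ⊗ₘ S.inj y.2) ≫ (f ▷ i.top.obj ⊗ₘ g) ≫ q)) := by
  have resolve_source (x : R'.ι × S'.ι) :
      ∑ y : R.ι × S.ι, tubeDiagram p
          ((r ≫ o.redObj ◁ R.proj y.1) ≫ o.redObj ◁ (R.inj y.1 ≫ f ≫ R'.proj x.1))
          ((s ≫ S.proj y.2 ▷ o.blueObj) ≫ (S.inj y.2 ≫ g ≫ S'.proj x.2) ▷ o.blueObj)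
          ((R'.inj x.1 ▷ i.top.obj ⊗ₘ S'.inj x.2) ≫ q) =
        tubeDiagram p (r ≫ o.redObj ◁ f ≫ o.redObj ◁ R'.proj x.1)
          (s ≫ g ▷ o.blueObj ≫ S'.proj x.2 ▷ o.blueObj)
          ((R'.inj x.1 ▷ i.top.obj ⊗ₘ S'.inj x.2) ≫ q) := by
    simp only [tubeDiagram, Fintype.sum_prod_type, ← tmul_sum, ← sum_tmul, Category.assoc,
      ← comp_whiskerRight, ← MonoidalCategory.whiskerLeft_comp, ← Preadditive.comp_sum,
      ← whiskerLeft_sum, ← sum_whiskerRight]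
    simp only [← Category.assoc, ← Preadditive.sum_comp, R.total, S.total, Category.id_comp]
  have resolve_target (y : R.ι × S.ι) :
      (R.inj y.1 ▷ i.top.obj ⊗ₘ S.inj y.2) ≫ (f ▷ i.top.obj ⊗ₘ g) ≫ q =
        ∑ x : R'.ι × S'.ι,
          ((R.inj y.1 ≫ f ≫ R'.proj x.1) ▷ i.top.obj ⊗ₘ (S.inj y.2 ≫ g ≫ S'.proj x.2)) ≫
            (R'.inj x.1 ▷ i.top.obj ⊗ₘ S'.inj x.2) ≫ q := by
    conv_lhs => rw [← Category.id_comp q, ← R'.sum_flank S']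
    simp only [Preadditive.sum_comp, Preadditive.comp_sum, comp_whiskerRight,
      ← tensorHom_comp_tensorHom, Category.assoc]
  simp only [resolve_target, tubeDiagram_sum_top, map_sum]
  rw [Finset.sum_comm]
  refine Finset.sum_congr rfl fun x _ => ?_
  rw [← resolve_source, map_sum]
  exact Finset.sum_congr rfl fun y _ => hΦ.slide_top ..

theorem sum_resolution (hΦ : IsDinatural ob Φ) (m : J → I) {a a' b b' : I}
    (R : Resolution (fun x => ob (m x)) (ob a)) (R' : Resolution (fun x => ob (m x)) (ob a'))
    (S : Resolution (fun x => ob (m x)) (ob b)) (S' : Resolution (fun x => ob (m x)) (ob b'))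
    (p : o.bot.obj ⟶ (ob a ⊗ i.bot.obj) ⊗ ob b) (r : ob a ⊗ i.redObj ⟶ o.redObj ⊗ ob a')
    (s : i.blueObj ⊗ ob b ⟶ ob b' ⊗ o.blueObj) (q : (ob a' ⊗ i.top.obj) ⊗ ob b' ⟶ o.top.obj) :
    ∑ y : R'.ι × S'.ι, ∑ x : R.ι × S.ι,
      Φ (m (R.label x.1)) (m (R'.label y.1)) (m (S.label x.2)) (m (S'.label y.2))
        (tubeDiagram (p ≫ (R.proj x.1 ▷ i.bot.obj ⊗ₘ S.proj x.2))
          (R.inj x.1 ▷ i.redObj ≫ r ≫ o.redObj ◁ R'.proj y.1)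
          (i.blueObj ◁ S.inj x.2 ≫ s ≫ S'.proj y.2 ▷ o.blueObj)
          ((R'.inj y.1 ▷ i.top.obj ⊗ₘ S'.inj y.2) ≫ q)) =
      Φ a a' b b' (tubeDiagram p r s q) := by
  have slide (x : R.ι × S.ι) (y : R'.ι × S'.ι) :
      Φ (m (R.label x.1)) (m (R'.label y.1)) (m (S.label x.2)) (m (S'.label y.2))
        (tubeDiagram (p ≫ (R.proj x.1 ▷ i.bot.obj ⊗ₘ S.proj x.2))
          (R.inj x.1 ▷ i.redObj ≫ r ≫ o.redObj ◁ R'.proj y.1)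
          (i.blueObj ◁ S.inj x.2 ≫ s ≫ S'.proj y.2 ▷ o.blueObj)
          ((R'.inj y.1 ▷ i.top.obj ⊗ₘ S'.inj y.2) ≫ q)) =
      Φ a a' b b' (tubeDiagram p
        ((R.proj x.1 ≫ R.inj x.1) ▷ i.redObj ≫ r ≫ o.redObj ◁ (R'.proj y.1 ≫ R'.inj y.1))
        (i.blueObj ◁ (S.proj x.2 ≫ S.inj x.2) ≫ s ≫ (S'.proj y.2 ≫ S'.inj y.2) ▷ o.blueObj)
        q) := by
    rw [hΦ.slide_bot, ← hΦ.slide_top]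
    simp only [comp_whiskerRight, MonoidalCategory.whiskerLeft_comp, Category.assoc]
  simp only [slide, ← map_sum, tubeDiagram, Fintype.sum_prod_type, ← tmul_sum, ← sum_tmul,
    ← Preadditive.comp_sum, ← Preadditive.sum_comp, ← whiskerLeft_sum, ← sum_whiskerRight,
    Resolution.total, id_whiskerRight, whiskerLeft_id, Category.id_comp, Category.comp_id]

end IsDinatural

variable [MonoidalPreadditive D] [MonoidalLinear ℂ D] [RigidCategory D] [IsMultifusion D]

theorem isDinatural_of : IsDinatural Irr.obj
    fun a a' b b' : Irr D => TubeBlock.of (o := o) (i := i) ⟨a, a', b, b'⟩ where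
  slide_bot f g p r s q := by
    induction f using Irr.hom_induction (C := D) ℂ with
    | zero => simp [tubeDiagram, MonoidalPreadditive.zero_tensor]
    | smul_id a c =>
      induction g using Irr.hom_induction (C := D) ℂ with
      | zero => simp [tubeDiagram, MonoidalPreadditive.tensor_zero]
      | smul_id b d => simp [tubeDiagram, tensorHom_smul, smul_tmul]
  slide_top f g p r s q := by
    induction f using Irr.hom_induction (C := D) ℂ with
    | zero => simp [tubeDiagram, MonoidalPreadditive.zero_tensor]
    | smul_id a c =>
      induction g using Irr.hom_induction (C := D) ℂ with
      | zero => simp [tubeDiagram, MonoidalPreadditive.tensor_zero]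
      | smul_id b d => simp [tubeDiagram, tensorHom_smul, smul_tmul]

theorem parallelMove_tubeDiagram {A A' B B' : D} (p : o.bot.obj ⟶ (A ⊗ i.bot.obj) ⊗ B)
    (r : A ⊗ i.redObj ⟶ o.redObj ⊗ A') (s : i.blueObj ⊗ B ⟶ B' ⊗ o.blueObj)
    (q : (A' ⊗ i.top.obj) ⊗ B' ⟶ o.top.obj) :
    let R := simpleResolution A
    let R' := simpleResolution A'
    let S := simpleResolution B
    let S' := simpleResolution B'
    parallelMove A A' B B' o i (tubeDiagram p r s q) =
      ∑ y : R'.ι × S'.ι, ∑ x : R.ι × S.ι,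
        TubeBlock.of ⟨R.label x.1, R'.label y.1, S.label x.2, S'.label y.2⟩
          (tubeDiagram (p ≫ (R.proj x.1 ▷ i.bot.obj ⊗ₘ S.proj x.2))
            (R.inj x.1 ▷ i.redObj ≫ r ≫ o.redObj ◁ R'.proj y.1)
            (i.blueObj ◁ S.inj x.2 ≫ s ≫ S'.proj y.2 ▷ o.blueObj)
            ((R'.inj y.1 ▷ i.top.obj ⊗ₘ S'.inj y.2) ≫ q)) := by
  intro R R' S S'
  simp only [parallelMove, LinearMap.sum_apply, LinearMap.comp_apply]
  simp only [Fintype.sum_prod_type]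
  exact Finset.sum_comm.trans <| Finset.sum_congr rfl fun _ _ =>
    (Finset.sum_congr rfl fun _ _ => Finset.sum_comm).trans Finset.sum_comm

theorem parallelMove_of (k : TubeArcs D)
    (X : TubeDiagram k.redBot.obj k.redTop.obj k.blueBot.obj k.blueTop.obj o i) :
    parallelMove _ _ _ _ o i X = TubeBlock.of k X := by
  induction X using TubeDiagram.induction with
  | zero => rw [map_zero, map_zero]
  | add X Y hX hY => rw [map_add, map_add, hX, hY]
  | pure p r s q =>
    exact (parallelMove_tubeDiagram p r s q).trans (isDinatural_of.sum_resolution id ..)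

theorem isDinatural_parallelMove :
    IsDinatural (fun A : D => A) fun A A' B B' => parallelMove A A' B B' o i where
  slide_bot f g p r s q := by
    simp only [parallelMove_tubeDiagram]
    refine Finset.sum_congr rfl fun y _ => ?_
    simp only [Category.assoc]
    exact isDinatural_of.sum_slide_bot (simpleResolution _) (simpleResolution _)
      (simpleResolution _) (simpleResolution _) f g p _ _ _
  slide_top {a a' b b' P Q} f g p r s q := by
    simp only [parallelMove_tubeDiagram]
    conv_lhs => rw [Finset.sum_comm]
    conv_rhs => rw [Finset.sum_comm]
    refine Finset.sum_congr rfl fun x _ => ?_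
    simpa only [Category.assoc] using isDinatural_of.sum_slide_top
      (simpleResolution a') (simpleResolution P) (simpleResolution b') (simpleResolution Q) f g
      (p ≫ ((simpleResolution a).proj x.1 ▷ i.bot.obj ⊗ₘ (simpleResolution b).proj x.2))
      ((simpleResolution a).inj x.1 ▷ i.redObj ≫ r)
      (i.blueObj ◁ (simpleResolution b).inj x.2 ≫ s) q

theorem IsDinatural.apply_parallelMove {W : Type*} [AddCommGroup W] [Module ℂ W]
    {Φ : ∀ A A' B B' : D, TubeDiagram A A' B B' o i →ₗ[ℂ] W}
    (hΦ : IsDinatural (fun A : D => A) Φ) {L : TubeBlock o i →ₗ[ℂ] W}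
    (hL : ∀ k X, L (TubeBlock.of k X) = Φ _ _ _ _ X) {A A' B B' : D}
    (X : TubeDiagram A A' B B' o i) : L (parallelMove A A' B B' o i X) = Φ A A' B B' X := by
  induction X using TubeDiagram.induction with
  | zero => simp only [map_zero]
  | add X Y hX hY => simp only [map_add, hX, hY]
  | pure p r s q =>
    rw [parallelMove_tubeDiagram]
    simp only [map_sum, hL]
    exact hΦ.sum_resolution Irr.obj _ _ _ _ p r s q

end

/-! ### Stacking tubes with arbitrary arcs -/

section

variable {D : Type u} [Category.{v} D] [MonoidalCategory D]

theorem nestIso_inv_naturality {A A₁ A₂ A₃ V V' B₂ B₃ B B₁ : D} (f : A ⟶ A₁) (f₂ : A₂ ⟶ A₃)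
    (w : V ⟶ V') (h₂ : B₂ ⟶ B₃) (h : B ⟶ B₁) :
    (nestIso A A₂ V B₂ B).inv ≫ (((f ⊗ₘ f₂) ⊗ₘ w) ⊗ₘ (h₂ ⊗ₘ h)) =
      ((f ⊗ₘ ((f₂ ⊗ₘ w) ⊗ₘ h₂)) ⊗ₘ h) ≫ (nestIso A₁ A₃ V' B₃ B₁).inv := by
  simp only [nestIso, Iso.trans_inv, Iso.symm_inv, whiskerRightIso_inv,
    MonoidalCategory.tensorHom_def]
  monoidal

theorem nestIso_hom_naturality {A A₁ A₂ A₃ V V' B₂ B₃ B B₁ : D} (f : A ⟶ A₁) (f₂ : A₂ ⟶ A₃)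
    (w : V ⟶ V') (h₂ : B₂ ⟶ B₃) (h : B ⟶ B₁) :
    (((f ⊗ₘ f₂) ⊗ₘ w) ⊗ₘ (h₂ ⊗ₘ h)) ≫ (nestIso A₁ A₃ V' B₃ B₁).hom =
      (nestIso A A₂ V B₂ B).hom ≫ ((f ⊗ₘ ((f₂ ⊗ₘ w) ⊗ₘ h₂)) ⊗ₘ h) := by
  rw [← Iso.inv_comp_eq, ← Category.assoc, nestIso_inv_naturality, Category.assoc,
    Iso.inv_hom_id, Category.comp_id]

variable [Abelian D] [Linear ℂ D] [MonoidalPreadditive D] [MonoidalLinear ℂ D]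

theorem botStack_apply (A A₂ B₂ B y v' v : D) (p : y ⟶ (A ⊗ v') ⊗ B)
    (p₂ : v' ⟶ (A₂ ⊗ v) ⊗ B₂) :
    botStack A A₂ B₂ B y v' v p p₂ = p ≫ ((A ◁ p₂) ▷ B) ≫ (nestIso A A₂ v B₂ B).inv :=
  rfl

theorem topStack_apply (A A₂ B₂ B x u' u : D) (q : (A ⊗ u') ⊗ B ⟶ x)
    (q₂ : (A₂ ⊗ u) ⊗ B₂ ⟶ u') :
    topStack A A₂ B₂ B x u' u q q₂ = (nestIso A A₂ u B₂ B).hom ≫ ((A ◁ q₂) ▷ B) ≫ q :=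
  rfl

theorem redStack_apply (A A' A₂ A₂' E C C₂ : D) (r : A ⊗ C ⟶ E ⊗ A')
    (r₂ : A₂ ⊗ C₂ ⟶ C ⊗ A₂') :
    redStack A A' A₂ A₂' E C C₂ r r₂ =
      (α_ _ _ _).hom ≫ (A ◁ r₂) ≫ (α_ _ _ _).inv ≫ (r ▷ A₂') ≫ (α_ _ _ _).hom :=
  rfl

theorem blueStack_apply (B B' B₂ B₂' G C C₂ : D) (s : C ⊗ B ⟶ B' ⊗ G)
    (s₂ : C₂ ⊗ B₂ ⟶ B₂' ⊗ C) :
    blueStack B B' B₂ B₂' G C C₂ s s₂ =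
      (α_ _ _ _).inv ≫ (s₂ ▷ B) ≫ (α_ _ _ _).hom ≫ (B₂' ◁ s) ≫ (α_ _ _ _).inv :=
  rfl

section Naturality

variable {A A' A₁ A₂ A₂' B B' B₁ B₂ B₂' C C₂ E x y w w' : D}

theorem botStack_comp_outer (p : y ⟶ (A ⊗ w') ⊗ B) (p₂ : w' ⟶ (A₂ ⊗ w) ⊗ B₂) (f : A ⟶ A₁)
    (h : B ⟶ B₁) :
    botStack A₁ A₂ B₂ B₁ y w' w (p ≫ (f ▷ w' ⊗ₘ h)) p₂ =
      botStack A A₂ B₂ B y w' w p p₂ ≫ ((f ▷ A₂) ▷ w ⊗ₘ B₂ ◁ h) := by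
  have := nestIso_inv_naturality f (𝟙 A₂) (𝟙 w) (𝟙 B₂) h
  simp only [tensorHom_id, id_tensorHom, id_whiskerRight] at this
  simp only [botStack_apply, Category.assoc, this]
  simp only [← tensorHom_id, ← id_tensorHom, tensorHom_comp_tensorHom_assoc,
    tensorHom_comp_tensorHom, Category.id_comp, Category.comp_id]

theorem botStack_comp_inner (p : y ⟶ (A ⊗ w') ⊗ B) (p₂ : w' ⟶ (A₂ ⊗ w) ⊗ B₂) (f : A₂ ⟶ A₁)
    (h : B₂ ⟶ B₁) :
    botStack A A₁ B₁ B y w' w p (p₂ ≫ (f ▷ w ⊗ₘ h)) =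
      botStack A A₂ B₂ B y w' w p p₂ ≫ ((A ◁ f) ▷ w ⊗ₘ h ▷ B) := by
  have := nestIso_inv_naturality (𝟙 A) f (𝟙 w) h (𝟙 B)
  simp only [tensorHom_id, id_tensorHom] at this
  simp only [botStack_apply, Category.assoc, this, MonoidalCategory.whiskerLeft_comp,
    comp_whiskerRight]

theorem topStack_comp_outer (q : (A ⊗ w') ⊗ B ⟶ x) (q₂ : (A₂ ⊗ w) ⊗ B₂ ⟶ w') (f : A₁ ⟶ A)
    (h : B₁ ⟶ B) :
    topStack A₁ A₂ B₂ B₁ x w' w ((f ▷ w' ⊗ₘ h) ≫ q) q₂ =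
      ((f ▷ A₂) ▷ w ⊗ₘ B₂ ◁ h) ≫ topStack A A₂ B₂ B x w' w q q₂ := by
  have := nestIso_hom_naturality f (𝟙 A₂) (𝟙 w) (𝟙 B₂) h
  simp only [tensorHom_id, id_tensorHom, id_whiskerRight] at this
  simp only [topStack_apply, reassoc_of% this]
  simp only [← tensorHom_id, ← id_tensorHom, tensorHom_comp_tensorHom_assoc,
    tensorHom_comp_tensorHom, Category.id_comp, Category.comp_id]

theorem topStack_comp_inner (q : (A ⊗ w') ⊗ B ⟶ x) (q₂ : (A₂ ⊗ w) ⊗ B₂ ⟶ w') (f : A₁ ⟶ A₂)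
    (h : B₁ ⟶ B₂) :
    topStack A A₁ B₁ B x w' w q ((f ▷ w ⊗ₘ h) ≫ q₂) =
      ((A ◁ f) ▷ w ⊗ₘ h ▷ B) ≫ topStack A A₂ B₂ B x w' w q q₂ := by
  have := nestIso_hom_naturality (𝟙 A) f (𝟙 w) h (𝟙 B)
  simp only [tensorHom_id, id_tensorHom] at this
  simp only [topStack_apply, reassoc_of% this, MonoidalCategory.whiskerLeft_comp,
    comp_whiskerRight, Category.assoc]

theorem redStack_comp_outer (f : A₁ ⟶ A) (r : A ⊗ C ⟶ E ⊗ A') (r₂ : A₂ ⊗ C₂ ⟶ C ⊗ A₂') :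
    redStack A₁ A' A₂ A₂' E C C₂ (f ▷ C ≫ r) r₂ =
      (f ▷ A₂) ▷ C₂ ≫ redStack A A' A₂ A₂' E C C₂ r r₂ := by
  simp only [redStack_apply, comp_whiskerRight, Category.assoc]
  rw [associator_naturality_left_assoc, ← whisker_exchange_assoc,
    associator_inv_naturality_left_assoc]

theorem redStack_outer_comp (r : A ⊗ C ⟶ E ⊗ A') (g : A' ⟶ A₁) (r₂ : A₂ ⊗ C₂ ⟶ C ⊗ A₂') :
    redStack A A₁ A₂ A₂' E C C₂ (r ≫ E ◁ g) r₂ =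
      redStack A A' A₂ A₂' E C C₂ r r₂ ≫ E ◁ (g ▷ A₂') := by
  simp only [redStack_apply, comp_whiskerRight, Category.assoc, associator_naturality_middle]

theorem redStack_comp_inner (r : A ⊗ C ⟶ E ⊗ A') (f : A₁ ⟶ A₂) (r₂ : A₂ ⊗ C₂ ⟶ C ⊗ A₂') :
    redStack A A' A₁ A₂' E C C₂ r (f ▷ C₂ ≫ r₂) =
      (A ◁ f) ▷ C₂ ≫ redStack A A' A₂ A₂' E C C₂ r r₂ := by
  simp only [redStack_apply, MonoidalCategory.whiskerLeft_comp, Category.assoc,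
    associator_naturality_middle_assoc]

theorem redStack_inner_comp (r : A ⊗ C ⟶ E ⊗ A') (r₂ : A₂ ⊗ C₂ ⟶ C ⊗ A₂') (g : A₂' ⟶ A₁) :
    redStack A A' A₂ A₁ E C C₂ r (r₂ ≫ C ◁ g) =
      redStack A A' A₂ A₂' E C C₂ r r₂ ≫ E ◁ (A' ◁ g) := by
  simp only [redStack_apply, MonoidalCategory.whiskerLeft_comp, Category.assoc,
    associator_inv_naturality_right_assoc, whisker_exchange_assoc, associator_naturality_right]

theorem blueStack_comp_outer (h : B₁ ⟶ B) (s : C ⊗ B ⟶ B' ⊗ E) (s₂ : C₂ ⊗ B₂ ⟶ B₂' ⊗ C) :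
    blueStack B₁ B' B₂ B₂' E C C₂ (C ◁ h ≫ s) s₂ =
      C₂ ◁ (B₂ ◁ h) ≫ blueStack B B' B₂ B₂' E C C₂ s s₂ := by
  simp only [blueStack_apply, MonoidalCategory.whiskerLeft_comp, Category.assoc,
    associator_inv_naturality_right_assoc, whisker_exchange_assoc,
    associator_naturality_right_assoc]

theorem blueStack_outer_comp (s : C ⊗ B ⟶ B' ⊗ E) (k : B' ⟶ B₁) (s₂ : C₂ ⊗ B₂ ⟶ B₂' ⊗ C) :
    blueStack B B₁ B₂ B₂' E C C₂ (s ≫ k ▷ E) s₂ =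
      blueStack B B' B₂ B₂' E C C₂ s s₂ ≫ (B₂' ◁ k) ▷ E := by
  simp only [blueStack_apply, MonoidalCategory.whiskerLeft_comp, Category.assoc,
    associator_inv_naturality_middle]

theorem blueStack_comp_inner (s : C ⊗ B ⟶ B' ⊗ E) (h : B₁ ⟶ B₂) (s₂ : C₂ ⊗ B₂ ⟶ B₂' ⊗ C) :
    blueStack B B' B₁ B₂' E C C₂ s (C₂ ◁ h ≫ s₂) =
      C₂ ◁ (h ▷ B) ≫ blueStack B B' B₂ B₂' E C C₂ s s₂ := by
  simp only [blueStack_apply, comp_whiskerRight, Category.assoc,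
    associator_inv_naturality_middle_assoc]

theorem blueStack_inner_comp (s : C ⊗ B ⟶ B' ⊗ E) (s₂ : C₂ ⊗ B₂ ⟶ B₂' ⊗ C) (k : B₂' ⟶ B₁) :
    blueStack B B' B₂ B₁ E C C₂ s (s₂ ≫ k ▷ C) =
      blueStack B B' B₂ B₂' E C C₂ s s₂ ≫ (k ▷ B') ▷ E := by
  simp only [blueStack_apply, comp_whiskerRight, Category.assoc]
  rw [associator_naturality_left_assoc, ← whisker_exchange_assoc, associator_inv_naturality_left]

end Naturality

theorem botStack_assoc {A A₂ A₃ B B₂ B₃ y v v₂ v₃ : D} (p : y ⟶ (A ⊗ v) ⊗ B)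
    (p₂ : v ⟶ (A₂ ⊗ v₂) ⊗ B₂) (p₃ : v₂ ⟶ (A₃ ⊗ v₃) ⊗ B₃) :
    botStack _ _ _ _ _ _ _ (botStack _ _ _ _ _ _ _ p p₂) p₃ ≫
        ((α_ A A₂ A₃).hom ▷ v₃ ⊗ₘ (α_ B₃ B₂ B).inv) =
      botStack _ _ _ _ _ _ _ p (botStack _ _ _ _ _ _ _ p₂ p₃) := by
  simp only [botStack_apply, nestIso, Iso.trans_inv, Iso.symm_inv, whiskerRightIso_inv]
  monoidal

theorem topStack_assoc {A A₂ A₃ B B₂ B₃ y v v₂ v₃ : D} (p : (A ⊗ v) ⊗ B ⟶ y)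
    (p₂ : (A₂ ⊗ v₂) ⊗ B₂ ⟶ v) (p₃ : (A₃ ⊗ v₃) ⊗ B₃ ⟶ v₂) :
    topStack _ _ _ _ _ _ _ (topStack _ _ _ _ _ _ _ p p₂) p₃ =
      ((α_ A A₂ A₃).hom ▷ v₃ ⊗ₘ (α_ B₃ B₂ B).inv) ≫
        topStack _ _ _ _ _ _ _ p (topStack _ _ _ _ _ _ _ p₂ p₃) := by
  simp only [topStack_apply, nestIso, Iso.trans_hom, Iso.symm_hom, whiskerRightIso_hom]
  monoidal

theorem redStack_assoc {A A₂ A₃ A' A₂' A₃' E C C₂ C₃ : D} (r : A ⊗ C ⟶ E ⊗ A')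
    (r₂ : A₂ ⊗ C₂ ⟶ C ⊗ A₂') (r₃ : A₃ ⊗ C₃ ⟶ C₂ ⊗ A₃') :
    redStack _ _ _ _ _ _ _ (redStack _ _ _ _ _ _ _ r r₂) r₃ ≫ E ◁ (α_ A' A₂' A₃').hom =
      (α_ A A₂ A₃).hom ▷ C₃ ≫ redStack _ _ _ _ _ _ _ r (redStack _ _ _ _ _ _ _ r₂ r₃) := by
  simp only [redStack_apply]
  monoidal

theorem blueStack_assoc {B B₂ B₃ B' B₂' B₃' E C C₂ C₃ : D} (s : C ⊗ B ⟶ B' ⊗ E)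
    (s₂ : C₂ ⊗ B₂ ⟶ B₂' ⊗ C) (s₃ : C₃ ⊗ B₃ ⟶ B₃' ⊗ C₂) :
    blueStack _ _ _ _ _ _ _ (blueStack _ _ _ _ _ _ _ s s₂) s₃ ≫ (α_ B₃' B₂' B').inv ▷ E =
      C₃ ◁ (α_ B₃ B₂ B).inv ≫ blueStack _ _ _ _ _ _ _ s (blueStack _ _ _ _ _ _ _ s₂ s₃) := by
  simp only [blueStack_apply]
  monoidal

theorem botStack_leftUnit {A B y v : D} (p : y ⟶ (A ⊗ v) ⊗ B) :
    botStack (𝟙_ D) A B (𝟙_ D) y y v ((λ_ y).inv ≫ (ρ_ _).inv) p ≫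
      ((λ_ A).hom ▷ v ⊗ₘ (ρ_ B).hom) = p := by
  simp only [botStack_apply, nestIso, Iso.trans_inv, Iso.symm_inv, whiskerRightIso_inv]
  monoidal

theorem topStack_leftUnit {A B y v : D} (q : (A ⊗ v) ⊗ B ⟶ y) :
    topStack (𝟙_ D) A B (𝟙_ D) y y v ((ρ_ _).hom ≫ (λ_ y).hom) q =
      ((λ_ A).hom ▷ v ⊗ₘ (ρ_ B).hom) ≫ q := by
  simp only [topStack_apply, nestIso, Iso.trans_hom, Iso.symm_hom, whiskerRightIso_hom]
  monoidal

theorem redStack_leftUnit {A A' E C : D} (r : A ⊗ C ⟶ E ⊗ A') :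
    redStack _ _ _ _ _ _ _ ((λ_ E).hom ≫ (ρ_ E).inv) r ≫ E ◁ (λ_ A').hom =
      (λ_ A).hom ▷ C ≫ r := by
  simp only [redStack_apply]
  monoidal

theorem blueStack_leftUnit {B B' G C : D} (s : C ⊗ B ⟶ B' ⊗ G) :
    blueStack _ _ _ _ _ _ _ ((ρ_ G).hom ≫ (λ_ G).inv) s ≫ (ρ_ B').hom ▷ G =
      C ◁ (ρ_ B).hom ≫ s := by
  simp only [blueStack_apply]
  monoidal

theorem botStack_rightUnit {A B y v : D} (p : y ⟶ (A ⊗ v) ⊗ B) :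
    botStack A (𝟙_ D) (𝟙_ D) B y v v p ((λ_ v).inv ≫ (ρ_ _).inv) ≫
      ((ρ_ A).hom ▷ v ⊗ₘ (λ_ B).hom) = p := by
  simp only [botStack_apply, nestIso, Iso.trans_inv, Iso.symm_inv, whiskerRightIso_inv]
  monoidal

theorem topStack_rightUnit {A B y v : D} (q : (A ⊗ v) ⊗ B ⟶ y) :
    topStack A (𝟙_ D) (𝟙_ D) B y v v q ((ρ_ _).hom ≫ (λ_ v).hom) =
      ((ρ_ A).hom ▷ v ⊗ₘ (λ_ B).hom) ≫ q := by
  simp only [topStack_apply, nestIso, Iso.trans_hom, Iso.symm_hom, whiskerRightIso_hom]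
  monoidal

theorem redStack_rightUnit {A A' E C : D} (r : A ⊗ C ⟶ E ⊗ A') :
    redStack _ _ _ _ _ _ _ r ((λ_ C).hom ≫ (ρ_ C).inv) ≫ E ◁ (ρ_ A').hom =
      (ρ_ A).hom ▷ C ≫ r := by
  simp only [redStack_apply]
  monoidal

theorem blueStack_rightUnit {B B' G C : D} (s : C ⊗ B ⟶ B' ⊗ G) :
    blueStack _ _ _ _ _ _ _ s ((ρ_ C).hom ≫ (λ_ C).inv) ≫ (λ_ B').hom ▷ G =
      C ◁ (λ_ B).hom ≫ s := by
  simp only [blueStack_apply]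
  monoidal

variable {m₀ m₁ m₂ n₀ n₁ n₂ : ℕ} {o : TubeBoundary D m₂ n₂}
  {c : TubeBoundary D m₁ n₁} {i : TubeBoundary D m₀ n₀} {A A' B B' A₂ A₂' B₂ B₂' : D}

theorem diagramStack_tubeDiagram (p : o.bot.obj ⟶ (A ⊗ c.bot.obj) ⊗ B)
    (r : A ⊗ c.redObj ⟶ o.redObj ⊗ A') (s : c.blueObj ⊗ B ⟶ B' ⊗ o.blueObj)
    (q : (A' ⊗ c.top.obj) ⊗ B' ⟶ o.top.obj) (p₂ : c.bot.obj ⟶ (A₂ ⊗ i.bot.obj) ⊗ B₂)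
    (r₂ : A₂ ⊗ i.redObj ⟶ c.redObj ⊗ A₂') (s₂ : i.blueObj ⊗ B₂ ⟶ B₂' ⊗ c.blueObj)
    (q₂ : (A₂' ⊗ i.top.obj) ⊗ B₂' ⟶ c.top.obj) :
    diagramStack A A' B B' A₂ A₂' B₂ B₂' o c i (tubeDiagram p r s q) (tubeDiagram p₂ r₂ s₂ q₂) =
      tubeDiagram (botStack _ _ _ _ _ _ _ p p₂) (redStack _ _ _ _ _ _ _ r r₂)
        (blueStack _ _ _ _ _ _ _ s s₂) (topStack _ _ _ _ _ _ _ q q₂) :=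
  rfl

variable [RigidCategory D] [IsMultifusion D]

/-- The combination of diagrams with simple edges which is represented by the tube diagram with
lower vertex `p`, red arc `r`, blue arc `s` and upper vertex `q`. -/
def tube (p : o.bot.obj ⟶ (A ⊗ i.bot.obj) ⊗ B) (r : A ⊗ i.redObj ⟶ o.redObj ⊗ A')
    (s : i.blueObj ⊗ B ⟶ B' ⊗ o.blueObj) (q : (A' ⊗ i.top.obj) ⊗ B' ⟶ o.top.obj) :
    TubeBlock o i :=
  parallelMove A A' B B' o i (tubeDiagram p r s q)

theorem isDinatural_diagramStack_outer (Y : TubeDiagram A₂ A₂' B₂ B₂' c i) :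
    IsDinatural (fun A : D => A) fun A A' B B' =>
      parallelMove (A ⊗ A₂) (A' ⊗ A₂') (B₂ ⊗ B) (B₂' ⊗ B') o i ∘ₗ
        (diagramStack A A' B B' A₂ A₂' B₂ B₂' o c i).flip Y where
  slide_bot f g p r s q := by
    induction Y using TubeDiagram.induction with
    | zero => simp only [map_zero, LinearMap.comp_zero, LinearMap.zero_apply]
    | add Y Z hY hZ => simp only [map_add, LinearMap.comp_add, LinearMap.add_apply, hY, hZ]
    | pure p₂ r₂ s₂ q₂ =>
      simp only [LinearMap.comp_apply, LinearMap.flip_apply, diagramStack_tubeDiagram,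
        botStack_comp_outer, redStack_comp_outer, blueStack_comp_outer]
      exact (isDinatural_parallelMove (o := o) (i := i)).slide_bot ..
  slide_top f g p r s q := by
    induction Y using TubeDiagram.induction with
    | zero => simp only [map_zero, LinearMap.comp_zero, LinearMap.zero_apply]
    | add Y Z hY hZ => simp only [map_add, LinearMap.comp_add, LinearMap.add_apply, hY, hZ]
    | pure p₂ r₂ s₂ q₂ =>
      simp only [LinearMap.comp_apply, LinearMap.flip_apply, diagramStack_tubeDiagram,
        topStack_comp_outer, redStack_outer_comp, blueStack_outer_comp]
      exact (isDinatural_parallelMove (o := o) (i := i)).slide_top ..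

theorem isDinatural_diagramStack_inner (X : TubeDiagram A A' B B' o c) :
    IsDinatural (fun A₂ : D => A₂) fun A₂ A₂' B₂ B₂' =>
      parallelMove (A ⊗ A₂) (A' ⊗ A₂') (B₂ ⊗ B) (B₂' ⊗ B') o i ∘ₗ
        diagramStack A A' B B' A₂ A₂' B₂ B₂' o c i X where
  slide_bot f g p₂ r₂ s₂ q₂ := by
    induction X using TubeDiagram.induction with
    | zero => simp only [map_zero, LinearMap.comp_zero, LinearMap.zero_apply]
    | add X Z hX hZ => simp only [map_add, LinearMap.comp_add, LinearMap.add_apply, hX, hZ]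
    | pure p r s q =>
      simp only [LinearMap.comp_apply, diagramStack_tubeDiagram,
        botStack_comp_inner, redStack_comp_inner, blueStack_comp_inner]
      exact (isDinatural_parallelMove (o := o) (i := i)).slide_bot ..
  slide_top f g p₂ r₂ s₂ q₂ := by
    induction X using TubeDiagram.induction with
    | zero => simp only [map_zero, LinearMap.comp_zero, LinearMap.zero_apply]
    | add X Z hX hZ => simp only [map_add, LinearMap.comp_add, LinearMap.add_apply, hX, hZ]
    | pure p r s q =>
      simp only [LinearMap.comp_apply, diagramStack_tubeDiagram,
        topStack_comp_inner, redStack_inner_comp, blueStack_inner_comp]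
      exact (isDinatural_parallelMove (o := o) (i := i)).slide_top ..

theorem blockStack_of_of (k k₂ : TubeArcs D)
    (X : TubeDiagram k.redBot.obj k.redTop.obj k.blueBot.obj k.blueTop.obj o c)
    (Y : TubeDiagram k₂.redBot.obj k₂.redTop.obj k₂.blueBot.obj k₂.blueTop.obj c i) :
    blockStack o c i (TubeBlock.of k X) (TubeBlock.of k₂ Y) =
      parallelMove _ _ _ _ o i (diagramStack _ _ _ _ _ _ _ _ o c i X Y) := by
  simp only [blockStack, TubeBlock.of, DirectSum.toModule_lof, LinearMap.flip_apply,
    LinearMap.compr₂_apply]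

theorem blockStack_parallelMove (X : TubeDiagram A A' B B' o c)
    (Y : TubeDiagram A₂ A₂' B₂ B₂' c i) :
    blockStack o c i (parallelMove _ _ _ _ o c X) (parallelMove _ _ _ _ c i Y) =
      parallelMove _ _ _ _ o i (diagramStack _ _ _ _ _ _ _ _ o c i X Y) := by
  refine (isDinatural_diagramStack_inner X).apply_parallelMove (fun k₂ Y => ?_) Y
  exact (isDinatural_diagramStack_outer Y).apply_parallelMove
    (L := (blockStack o c i).flip (TubeBlock.of k₂ Y)) (fun k X => blockStack_of_of k k₂ X Y) X

theorem blockStack_tube (p : o.bot.obj ⟶ (A ⊗ c.bot.obj) ⊗ B) (r : A ⊗ c.redObj ⟶ o.redObj ⊗ A')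
    (s : c.blueObj ⊗ B ⟶ B' ⊗ o.blueObj) (q : (A' ⊗ c.top.obj) ⊗ B' ⟶ o.top.obj)
    (p₂ : c.bot.obj ⟶ (A₂ ⊗ i.bot.obj) ⊗ B₂) (r₂ : A₂ ⊗ i.redObj ⟶ c.redObj ⊗ A₂')
    (s₂ : i.blueObj ⊗ B₂ ⟶ B₂' ⊗ c.blueObj) (q₂ : (A₂' ⊗ i.top.obj) ⊗ B₂' ⟶ c.top.obj) :
    blockStack o c i (tube p r s q) (tube p₂ r₂ s₂ q₂) =
      tube (botStack _ _ _ _ _ _ _ p p₂) (redStack _ _ _ _ _ _ _ r r₂)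
        (blueStack _ _ _ _ _ _ _ s s₂) (topStack _ _ _ _ _ _ _ q q₂) :=
  blockStack_parallelMove _ _

theorem TubeBlock.of_tubeDiagram (k : TubeArcs D)
    (p : o.bot.obj ⟶ (k.redBot.obj ⊗ i.bot.obj) ⊗ k.blueBot.obj)
    (r : k.redBot.obj ⊗ i.redObj ⟶ o.redObj ⊗ k.redTop.obj)
    (s : i.blueObj ⊗ k.blueBot.obj ⟶ k.blueTop.obj ⊗ o.blueObj)
    (q : (k.redTop.obj ⊗ i.top.obj) ⊗ k.blueTop.obj ⟶ o.top.obj) :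
    TubeBlock.of k (tubeDiagram p r s q) = tube p r s q :=
  (parallelMove_of k _).symm

theorem tube_congr {P P' Q Q' : D} (f : A ⟶ P) (f' : A' ⟶ P') (g : B ⟶ Q) (g' : B' ⟶ Q')
    {p : o.bot.obj ⟶ (A ⊗ i.bot.obj) ⊗ B} {r : A ⊗ i.redObj ⟶ o.redObj ⊗ A'}
    {s : i.blueObj ⊗ B ⟶ B' ⊗ o.blueObj} {q : (A' ⊗ i.top.obj) ⊗ B' ⟶ o.top.obj}
    {p₁ : o.bot.obj ⟶ (P ⊗ i.bot.obj) ⊗ Q} {r₁ : P ⊗ i.redObj ⟶ o.redObj ⊗ P'}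
    {s₁ : i.blueObj ⊗ Q ⟶ Q' ⊗ o.blueObj} {q₁ : (P' ⊗ i.top.obj) ⊗ Q' ⟶ o.top.obj}
    (hp : p ≫ (f ▷ i.bot.obj ⊗ₘ g) = p₁) (hr : r ≫ o.redObj ◁ f' = f ▷ i.redObj ≫ r₁)
    (hs : s ≫ g' ▷ o.blueObj = i.blueObj ◁ g ≫ s₁) (hq : q = (f' ▷ i.top.obj ⊗ₘ g') ≫ q₁) :
    tube p r s q = tube p₁ r₁ s₁ q₁ :=
  isDinatural_parallelMove.congr f f' g g' hp hr hs hq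

theorem blockStack_assoc {m₃ n₃ : ℕ} {e : TubeBoundary D m₃ n₃} (X : TubeBlock e o)
    (Y : TubeBlock o c) (Z : TubeBlock c i) :
    blockStack e c i (blockStack e o c X Y) Z = blockStack e o i X (blockStack o c i Y Z) := by
  induction X using TubeBlock.induction with
  | zero => simp only [map_zero, LinearMap.zero_apply]
  | add X X' hX hX' => simp only [map_add, LinearMap.add_apply, hX, hX']
  | of k p r s q =>
    induction Y using TubeBlock.induction with
    | zero => simp only [map_zero, LinearMap.zero_apply]
    | add Y Y' hY hY' => simp only [map_add, LinearMap.add_apply, hY, hY']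
    | of k₂ p₂ r₂ s₂ q₂ =>
      induction Z using TubeBlock.induction with
      | zero => simp only [map_zero]
      | add Z Z' hZ hZ' => simp only [map_add, hZ, hZ']
      | of k₃ p₃ r₃ s₃ q₃ =>
        simp only [TubeBlock.of_tubeDiagram, blockStack_tube]
        exact tube_congr (α_ _ _ _).hom (α_ _ _ _).hom (α_ _ _ _).inv (α_ _ _ _).inv
          (botStack_assoc ..) (redStack_assoc ..) (blueStack_assoc ..) (topStack_assoc ..)

/-- The unit of stacking on the circle with labels `o`: both arcs are labelled by the tensor unit
and every other edge runs straight through. -/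
def straightTube (o : TubeBoundary D m₂ n₂) : TubeBlock o o :=
  tube ((λ_ o.bot.obj).inv ≫ (ρ_ _).inv) ((λ_ o.redObj).hom ≫ (ρ_ o.redObj).inv)
    ((ρ_ o.blueObj).hom ≫ (λ_ o.blueObj).inv) ((ρ_ _).hom ≫ (λ_ o.top.obj).hom)

theorem straightTube_blockStack (X : TubeBlock o i) :
    blockStack o o i (straightTube o) X = X := by
  induction X using TubeBlock.induction with
  | zero => rw [map_zero]
  | add X X' hX hX' => rw [map_add, hX, hX']
  | of k p r s q =>
    rw [TubeBlock.of_tubeDiagram, straightTube, blockStack_tube]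
    exact tube_congr (λ_ _).hom (λ_ _).hom (ρ_ _).hom (ρ_ _).hom (botStack_leftUnit _)
      (redStack_leftUnit _) (blueStack_leftUnit _) (topStack_leftUnit _)

theorem blockStack_straightTube (X : TubeBlock o i) :
    blockStack o i i X (straightTube i) = X := by
  induction X using TubeBlock.induction with
  | zero => rw [map_zero, LinearMap.zero_apply]
  | add X X' hX hX' => rw [map_add, LinearMap.add_apply, hX, hX']
  | of k p r s q =>
    rw [TubeBlock.of_tubeDiagram, straightTube, blockStack_tube]
    exact tube_congr (ρ_ _).hom (ρ_ _).hom (λ_ _).hom (λ_ _).hom (botStack_rightUnit _)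
      (redStack_rightUnit _) (blueStack_rightUnit _) (topStack_rightUnit _)

theorem tubeStack_apply (X : TubeSpace D m₁ m₂ n₁ n₂) (Y : TubeSpace D m₀ m₁ n₀ n₁)
    (o : TubeBoundary D m₂ n₂) (i : TubeBoundary D m₀ n₀) :
    tubeStack X Y o i = ∑ c, blockStack o c i (X o c) (Y c i) :=
  rfl

theorem tubeOne_self (o : TubeBoundary D m₂ n₂) : tubeOne D m₂ n₂ o o = straightTube o :=
  Pi.single_eq_same (M := fun i => TubeBlock o i) o _

theorem tubeOne_of_ne {o i : TubeBoundary D m₂ n₂} (h : i ≠ o) : tubeOne D m₂ n₂ o i = 0 :=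
  Pi.single_eq_of_ne (M := fun i => TubeBlock o i) h _

theorem tubeLaws : TubeLaws D where
  assoc X Y Z := by
    funext o i
    simp only [tubeStack_apply, map_sum, LinearMap.sum_apply, blockStack_assoc]
    exact Finset.sum_comm
  one_stack X := by
    funext o i
    rw [tubeStack_apply, Finset.sum_eq_single o, tubeOne_self, straightTube_blockStack]
    · intro c _ h
      rw [tubeOne_of_ne h, map_zero, LinearMap.zero_apply]
    · exact fun h => absurd (Finset.mem_univ o) h
  stack_one X := by
    funext o i
    rw [tubeStack_apply, Finset.sum_eq_single i, tubeOne_self, blockStack_straightTube]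
    · intro c _ h
      rw [tubeOne_of_ne h.symm, map_zero]
    · exact fun h => absurd (Finset.mem_univ i) h

end

/-! ### Morita contexts -/

section

universe w

/-- A Morita context between the `k`-algebras `A` and `B`: bimodules `M` and `N` with compatible
associative pairings into `B` and `A`. -/
structure MoritaContext (k A B M N : Type*) [CommRing k] [Ring A] [Algebra k A] [Ring B]
    [Algebra k B] [AddCommGroup M] [Module k M] [Module B M] [Module Aᵐᵒᵖ M]
    [AddCommGroup N] [Module k N] [Module A N] [Module Bᵐᵒᵖ N] where
  /-- the pairing into `B` -/
  left : M →ₗ[k] N →ₗ[k] B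
  /-- the pairing into `A` -/
  right : N →ₗ[k] M →ₗ[k] A
  left_smul : ∀ (b : B) (x : M) (y : N), left (b • x) y = b * left x y
  left_balanced : ∀ (x : M) (a : A) (y : N), left (MulOpposite.op a • x) y = left x (a • y)
  left_op_smul : ∀ (x : M) (y : N) (b : B), left x (MulOpposite.op b • y) = left x y * b
  right_smul : ∀ (a : A) (y : N) (x : M), right (a • y) x = a * right y x
  right_balanced : ∀ (y : N) (b : B) (x : M), right (MulOpposite.op b • y) x = right y (b • x)
  right_op_smul : ∀ (y : N) (x : M) (a : A), right y (MulOpposite.op a • x) = right y x * a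
  left_smul_eq : ∀ (x : M) (y : N) (x' : M), left x y • x' = MulOpposite.op (right y x') • x
  right_smul_eq : ∀ (y : N) (x : M) (y' : N), right y x • y' = MulOpposite.op (left x y') • y

theorem BalancedTensor.tmul_smul (k : Type*) {A M N : Type*} [CommRing k] [Ring A] [Algebra k A]
    [AddCommGroup M] [Module k M] [Module Aᵐᵒᵖ M] [AddCommGroup N] [Module k N] [Module A N]
    (x : M) (a : A) (y : N) :
    BalancedTensor.tmul k A (MulOpposite.op a • x) y = BalancedTensor.tmul k A x (a • y) :=
  (Submodule.Quotient.eq _).2 (Submodule.subset_span ⟨x, a, y, rfl⟩)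

namespace MoritaContext

section

variable {k A B M N : Type*} [CommRing k] [Ring A] [Algebra k A] [Ring B]
  [Algebra k B] [AddCommGroup M] [Module k M] [Module B M] [Module Aᵐᵒᵖ M]
  [AddCommGroup N] [Module k N] [Module A N] [Module Bᵐᵒᵖ N] (C : MoritaContext k A B M N)

/-- The Morita context with the roles of the two algebras exchanged. -/
def swap : MoritaContext k B A N M where
  left := C.right
  right := C.left
  left_smul := C.right_smul
  left_balanced := C.right_balanced
  left_op_smul := C.right_op_smul
  right_smul := C.left_smul
  right_balanced := C.left_balanced
  right_op_smul := C.left_op_smul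
  left_smul_eq := C.right_smul_eq
  right_smul_eq := C.left_smul_eq

/-- The map `M ⊗_A N → B` induced by the pairing into `B`. -/
def balancedLift : BalancedTensor k A M N →ₗ[k] B :=
  Submodule.liftQ _ (lift C.left) <| Submodule.span_le.2 <| by
    rintro _ ⟨x, a, y, rfl⟩
    simp only [SetLike.mem_coe, LinearMap.mem_ker, map_sub, lift.tmul, C.left_balanced, sub_self]

theorem balancedLift_tmul (x : M) (y : N) : C.balancedLift (.tmul k A x y) = C.left x y :=
  rfl

variable [IsScalarTower k B M] [IsScalarTower k Bᵐᵒᵖ N]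

theorem mk_lift_left_smul (z w : M ⊗[k] N) :
    (Submodule.Quotient.mk (lift C.left w • z) : BalancedTensor k A M N) =
      Submodule.Quotient.mk
        ((Algebra.lsmul k k N (MulOpposite.op (lift C.left z))).lTensor M w) := by
  induction z with
  | zero => simp
  | add z z' hz hz' =>
    simp only [smul_add, Submodule.Quotient.mk_add, hz, hz', map_add, MulOpposite.op_add,
      LinearMap.lTensor_add, LinearMap.add_apply]
  | tmul x y =>
    induction w with
    | zero => simp only [map_zero, zero_smul]
    | add w w' hw hw' => simp only [map_add, add_smul, Submodule.Quotient.mk_add, hw, hw']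
    | tmul x' y' =>
      calc BalancedTensor.tmul k A (C.left x' y' • x) y
        _ = .tmul k A x' (C.right y' x • y) := by rw [C.left_smul_eq, BalancedTensor.tmul_smul]
        _ = .tmul k A x' (MulOpposite.op (C.left x y) • y') := by rw [C.right_smul_eq]

theorem balancedLift_bijective (h : 1 ∈ LinearMap.range (lift C.left)) :
    Function.Bijective C.balancedLift := by
  obtain ⟨z, hz⟩ := h
  refine ⟨(injective_iff_map_eq_zero _).2 fun w => ?_, fun b => ?_⟩
  · induction w using Submodule.Quotient.induction_on with
    | H w =>
      intro hw
      have := C.mk_lift_left_smul z w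
      rw [hz, MulOpposite.op_one, map_one, show lift C.left w = 0 from hw, zero_smul] at this
      exact (this.trans (congrArg _ (LinearMap.lTensor_id_apply M N w))).symm
  · have lift_smul (z : M ⊗[k] N) : lift C.left (b • z) = b * lift C.left z := by
      induction z with
      | zero => simp
      | add z z' hz hz' => simp only [smul_add, map_add, hz, hz', mul_add]
      | tmul x y => exact C.left_smul b x y
    exact ⟨Submodule.Quotient.mk (b • z), (lift_smul z).trans (by rw [hz, mul_one])⟩

end

section

variable (A B N : Type*) [Ring A] [Ring B] [AddCommGroup N] [Module A N] [Module Bᵐᵒᵖ N]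
  [SMulCommClass A Bᵐᵒᵖ N]

/-- The `A`-linear maps out of an `A`-`B`-bimodule, as a left `B`-module by precomposition. -/
def BimoduleHom (X : Type*) [AddCommGroup X] [Module A X] : Type _ := N →ₗ[A] X

variable {A B N} {X Y : Type*} [AddCommGroup X] [Module A X] [AddCommGroup Y] [Module A Y]

instance : AddCommGroup (BimoduleHom A N X) := inferInstanceAs (AddCommGroup (N →ₗ[A] X))

instance : FunLike (BimoduleHom A N X) N X := inferInstanceAs (FunLike (N →ₗ[A] X) N X)

instance : LinearMapClass (BimoduleHom A N X) A N X :=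
  inferInstanceAs (LinearMapClass (N →ₗ[A] X) A N X)

@[ext]
theorem BimoduleHom.ext {φ ψ : BimoduleHom A N X} (h : ∀ n, φ n = ψ n) : φ = ψ :=
  LinearMap.ext h

instance : Module B (BimoduleHom A N X) where
  smul b φ :=
    ({ toFun := fun n => φ (MulOpposite.op b • n)
       map_add' := fun n n' => by rw [smul_add, map_add]
       map_smul' := fun a n => by rw [← smul_comm, map_smul, RingHom.id_apply] } : N →ₗ[A] X)
  one_smul φ := BimoduleHom.ext fun n => congrArg φ (one_smul Bᵐᵒᵖ n)
  mul_smul b c φ := BimoduleHom.ext fun n => congrArg φ (mul_smul (MulOpposite.op c)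
    (MulOpposite.op b) n)
  smul_zero _ := rfl
  smul_add _ _ _ := rfl
  add_smul b c φ := BimoduleHom.ext fun n =>
    (congrArg φ (add_smul (MulOpposite.op b) (MulOpposite.op c) n)).trans (map_add φ _ _)
  zero_smul φ := BimoduleHom.ext fun n =>
    (congrArg φ (zero_smul Bᵐᵒᵖ n)).trans (map_zero φ)

theorem BimoduleHom.smul_apply (b : B) (φ : BimoduleHom A N X) (n : N) :
    (b • φ) n = φ (MulOpposite.op b • n) := rfl

variable (B) in
/-- Composition with an `A`-linear map, as a `B`-linear map. -/
def BimoduleHom.map (f : X →ₗ[A] Y) : BimoduleHom A N X →ₗ[B] BimoduleHom A N Y where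
  toFun φ := (f.comp φ : N →ₗ[A] Y)
  map_add' φ ψ := BimoduleHom.ext fun n => map_add f (φ n) (ψ n)
  map_smul' _ _ := rfl

end

/-- The functor from `A`-modules to `B`-modules represented by an `A`-`B`-bimodule. -/
def bimoduleHomFunctor (A B : Type*) (N : Type w) [Ring A] [Ring B] [AddCommGroup N] [Module A N]
    [Module Bᵐᵒᵖ N] [SMulCommClass A Bᵐᵒᵖ N] : ModuleCat.{w} A ⥤ ModuleCat.{w} B where
  obj X := ModuleCat.of B (BimoduleHom A N X)
  map f := ModuleCat.ofHom (BimoduleHom.map B f.hom)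

section

variable {k A B M N : Type*} [CommRing k] [Ring A] [Algebra k A] [Ring B]
  [Algebra k B] [AddCommGroup M] [Module k M] [Module B M] [Module Aᵐᵒᵖ M]
  [AddCommGroup N] [Module k N] [Module A N] [Module Bᵐᵒᵖ N] (C : MoritaContext k A B M N)
  [SMulCommClass B Aᵐᵒᵖ M] [SMulCommClass A Bᵐᵒᵖ N]

/-- The map from a module to its double dual along a Morita context. -/
def bidual (X : Type*) [AddCommGroup X] [Module A X] :
    X →ₗ[A] BimoduleHom B M (BimoduleHom A N X) where
  toFun x :=
    ({ toFun := fun m =>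
        ({ toFun := fun n => C.right n m • x
           map_add' := fun n n' => by rw [map_add, LinearMap.add_apply, add_smul]
           map_smul' := fun a n => by rw [C.right_smul, mul_smul, RingHom.id_apply] } : N →ₗ[A] X)
       map_add' := fun m m' => BimoduleHom.ext fun n =>
        (congrArg (· • x) (map_add (C.right n) m m')).trans (add_smul ..)
       map_smul' := fun b m => BimoduleHom.ext fun n =>
        congrArg (· • x) (C.right_balanced n b m).symm } : M →ₗ[B] BimoduleHom A N X)
  map_add' x x' := BimoduleHom.ext fun m => BimoduleHom.ext fun n => smul_add (C.right n m) x x'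
  map_smul' a x := BimoduleHom.ext fun m => BimoduleHom.ext fun n =>
    (smul_smul ..).trans (congrArg (· • x) (C.right_op_smul n m a).symm)

theorem bidual_apply (X : Type*) [AddCommGroup X] [Module A X] (x : X) (m : M) (n : N) :
    C.bidual X x m n = C.right n m • x := rfl

theorem exists_bidual_eq {X : Type*} [AddCommGroup X] [Module A X]
    (φ : BimoduleHom B M (BimoduleHom A N X)) (z : N ⊗[k] M) :
    ∃ x, ∀ m n, C.bidual X x m n = φ (MulOpposite.op (lift C.right z) • m) n := by
  induction z with
  | zero => exact ⟨0, fun m n => by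
      rw [map_zero, map_zero, MulOpposite.op_zero, zero_smul, map_zero]; rfl⟩
  | add z z' hz hz' =>
    obtain ⟨x, hx⟩ := hz
    obtain ⟨x', hx'⟩ := hz'
    refine ⟨x + x', fun m n => ?_⟩
    rw [bidual_apply, smul_add, ← bidual_apply, ← bidual_apply, hx, hx', map_add,
      MulOpposite.op_add, add_smul, map_add]
    rfl
  | tmul n₀ m₀ =>
    refine ⟨φ m₀ n₀, fun m n => ?_⟩
    rw [bidual_apply, lift.tmul, ← map_smul, C.right_smul_eq, ← BimoduleHom.smul_apply,
      ← map_smul, C.left_smul_eq]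

theorem bidual_bijective (h : 1 ∈ LinearMap.range (lift C.right)) (X : Type*) [AddCommGroup X]
    [Module A X] : Function.Bijective (C.bidual X) := by
  obtain ⟨z, hz⟩ := h
  refine ⟨(injective_iff_map_eq_zero _).2 fun x hx => ?_, fun φ => ?_⟩
  · have lift_smul (z : N ⊗[k] M) : lift C.right z • x = 0 := by
      induction z with
      | zero => rw [map_zero, zero_smul]
      | add z z' hz hz' => rw [map_add, add_smul, hz, hz', add_zero]
      | tmul n m => exact congrArg (fun φ : BimoduleHom B M (BimoduleHom A N X) => φ m n) hx
    rw [← one_smul A x, ← hz, lift_smul]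
  · obtain ⟨x, hx⟩ := C.exists_bidual_eq φ z
    exact ⟨x, BimoduleHom.ext fun m => BimoduleHom.ext fun n => by
      rw [hx, hz, MulOpposite.op_one, one_smul]⟩

end

section

variable {k A B : Type*} {M N : Type w} [CommRing k] [Ring A] [Algebra k A] [Ring B]
  [Algebra k B] [AddCommGroup M] [Module k M] [Module B M] [Module Aᵐᵒᵖ M]
  [AddCommGroup N] [Module k N] [Module A N] [Module Bᵐᵒᵖ N] (C : MoritaContext k A B M N)
  [SMulCommClass B Aᵐᵒᵖ M] [SMulCommClass A Bᵐᵒᵖ N]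

/-- The natural isomorphism from a module to its double dual. -/
def bidualIso (h : 1 ∈ LinearMap.range (lift C.right)) :
    𝟭 (ModuleCat.{w} A) ≅ bimoduleHomFunctor A B N ⋙ bimoduleHomFunctor B A M :=
  NatIso.ofComponents
    (fun X => (LinearEquiv.ofBijective (C.bidual X) (C.bidual_bijective h X)).toModuleIso)
    (fun f => by
      ext x
      exact BimoduleHom.ext fun m => BimoduleHom.ext fun n =>
        (map_smul f.hom (C.right n m) x).symm)

end

open scoped ModuleCat.Algebra in
theorem bimoduleHomFunctor_linear (k A B : Type*) (N : Type w) [CommRing k] [Ring A] [Algebra k A]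
    [Ring B] [Algebra k B] [AddCommGroup N] [Module k N] [Module A N] [Module Bᵐᵒᵖ N]
    [SMulCommClass A Bᵐᵒᵖ N] [IsScalarTower k A N] [IsScalarTower k Bᵐᵒᵖ N] :
    (bimoduleHomFunctor A B N).Linear k where
  map_smul {X Y} f c := by
    ext (φ : BimoduleHom A N X)
    refine BimoduleHom.ext fun n => ?_
    have hn : algebraMap k A c • n = MulOpposite.op (algebraMap k B c) • n := by
      rw [← MulOpposite.algebraMap_apply, algebraMap_smul, algebraMap_smul]
    change algebraMap k A c • f.hom (φ n) = f.hom (φ (MulOpposite.op (algebraMap k B c) • n))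
    rw [← hn, map_smul φ, map_smul f.hom]

theorem isMoritaEquivalent {k : Type*} {A : Type u} {B : Type v} {M N : Type max u v} [CommRing k]
    [Ring A] [Algebra k A] [Ring B] [Algebra k B] [AddCommGroup M] [Module k M] [Module B M]
    [Module Aᵐᵒᵖ M] [AddCommGroup N] [Module k N] [Module A N] [Module Bᵐᵒᵖ N]
    (C : MoritaContext k A B M N) [SMulCommClass B Aᵐᵒᵖ M] [SMulCommClass A Bᵐᵒᵖ N]
    [IsScalarTower k A N] [IsScalarTower k Bᵐᵒᵖ N] (hleft : 1 ∈ LinearMap.range (lift C.left))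
    (hright : 1 ∈ LinearMap.range (lift C.right)) : IsMoritaEquivalent k A B where
  cond := ⟨{
    eqv := CategoryTheory.Equivalence.mk (bimoduleHomFunctor A B N) (bimoduleHomFunctor B A M)
      (C.bidualIso hright) (C.swap.bidualIso hleft).symm
    linear := bimoduleHomFunctor_linear k A B N }⟩

end MoritaContext

end

/-! ### Factoring straight tubes through any number of legs -/

section

variable {D : Type u} [Category.{v} D] [Abelian D] [Linear ℂ D] [MonoidalCategory D]
  [MonoidalPreadditive D] [MonoidalLinear ℂ D]

theorem redStack_coevaluation {A A' E : D} [ExactPairing A A'] (f : 𝟙_ D ⟶ E) (g : E ⟶ 𝟙_ D) :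
    redStack (𝟙_ D) A' (𝟙_ D) A A E A ((λ_ E).hom ≫ g ≫ η_ A A') (f ▷ A) =
      (λ_ (𝟙_ D)).hom ▷ A ≫ (f ≫ g) ▷ A ≫ η_ A A' ▷ A ≫ (α_ _ _ _).hom := by
  rw [redStack_apply]
  monoidal

theorem blueStack_coevaluation {B B' E : D} [ExactPairing B' B] (f : 𝟙_ D ⟶ E) (g : E ⟶ 𝟙_ D) :
    blueStack (𝟙_ D) B' (𝟙_ D) B B E B ((ρ_ E).hom ≫ g ≫ η_ B' B) (B ◁ f) =
      B ◁ (ρ_ (𝟙_ D)).hom ≫ B ◁ (f ≫ g) ≫ B ◁ η_ B' B ≫ (α_ _ _ _).inv := by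
  rw [blueStack_apply]
  monoidal

variable [RigidCategory D] [IsMultifusion D]

variable (D) in
/-- A resolution of the tensor unit through products of `s` red legs. -/
def redUnitResolution : (s : ℕ) → Resolution (redProd (D := D) s) (𝟙_ D)
  | 0 => .refl (redProd 0) Fin.elim0
  | s + 1 => (((redUnitResolution s).tensor (simpleResolution (𝟙_ D))).ofIso (λ_ (𝟙_ D))).relabel
      (ob := redProd (s + 1)) fun x : (Fin s → Irr D) × Irr D => Fin.cons x.2 x.1

variable (D) in
/-- A resolution of the tensor unit through products of `t` blue legs. -/
def blueUnitResolution : (t : ℕ) → Resolution (blueProd (D := D) t) (𝟙_ D)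
  | 0 => .refl (blueProd 0) Fin.elim0
  | t + 1 => (((simpleResolution (𝟙_ D)).tensor (blueUnitResolution t)).ofIso (λ_ (𝟙_ D))).relabel
      (ob := blueProd (t + 1)) fun x : Irr D × (Fin t → Irr D) => Fin.cons x.1 x.2

variable {m n : ℕ} (o : TubeBoundary D m n) {s t : ℕ}

/-- The outer half of the factorization of a straight tube: the legs of `o` are bent into the upper
vertical edge and leave it again through `w`, and the inner legs `a` and `b` end in `g` and `g'`. -/
def bendTube (a : Fin s → Irr D) (b : Fin t → Irr D) (x : Irr D) (g : redProd s a ⟶ 𝟙_ D)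
    (g' : blueProd t b ⟶ 𝟙_ D) (w : x.obj ⟶ (o.redObj ⊗ o.top.obj) ⊗ o.blueObj) :
    TubeBlock o ⟨a, b, x, o.bot⟩ :=
  tube (A := 𝟙_ D) (A' := o.redObjᘁ) (B := 𝟙_ D) (B' := ᘁo.blueObj)
    ((λ_ o.bot.obj).inv ≫ (ρ_ _).inv)
    ((λ_ _).hom ≫ g ≫ η_ o.redObj o.redObjᘁ) ((ρ_ _).hom ≫ g' ≫ η_ (ᘁo.blueObj) o.blueObj)
    ((o.redObjᘁ ◁ w) ▷ (ᘁo.blueObj) ≫ (nestIso ..).inv ≫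
      (ε_ o.redObj o.redObjᘁ ▷ o.top.obj ⊗ₘ ε_ (ᘁo.blueObj) o.blueObj) ≫ (ρ_ _).hom ≫ (λ_ _).hom)

/-- The inner half of the factorization of a straight tube: the legs of `o` are absorbed into the
upper vertical edge through `w`, and the outer legs `a` and `b` start in `f` and `f'`. -/
def absorbTube (a : Fin s → Irr D) (b : Fin t → Irr D) (x : Irr D) (f : 𝟙_ D ⟶ redProd s a)
    (f' : 𝟙_ D ⟶ blueProd t b) (w : (o.redObj ⊗ o.top.obj) ⊗ o.blueObj ⟶ x.obj) :
    TubeBlock ⟨a, b, x, o.bot⟩ o :=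
  tube ((λ_ o.bot.obj).inv ≫ (ρ_ _).inv) (f ▷ o.redObj) (o.blueObj ◁ f') w

theorem bendTube_blockStack_absorbTube (a : Fin s → Irr D) (b : Fin t → Irr D) (x : Irr D)
    (f : 𝟙_ D ⟶ redProd s a) (g : redProd s a ⟶ 𝟙_ D) (f' : 𝟙_ D ⟶ blueProd t b)
    (g' : blueProd t b ⟶ 𝟙_ D) (w : (o.redObj ⊗ o.top.obj) ⊗ o.blueObj ⟶ x.obj)
    (w' : x.obj ⟶ (o.redObj ⊗ o.top.obj) ⊗ o.blueObj) :
    blockStack o _ o (bendTube o a b x g g' w') (absorbTube o a b x f f' w) =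
      tube (botStack _ _ _ _ _ _ _ ((λ_ o.bot.obj).inv ≫ (ρ_ _).inv)
          ((λ_ o.bot.obj).inv ≫ (ρ_ _).inv))
        ((λ_ (𝟙_ D)).hom ▷ o.redObj ≫ (f ≫ g) ▷ o.redObj ≫ η_ o.redObj o.redObjᘁ ▷ o.redObj ≫
          (α_ _ _ _).hom)
        (o.blueObj ◁ (ρ_ (𝟙_ D)).hom ≫ o.blueObj ◁ (f' ≫ g') ≫
          o.blueObj ◁ η_ (ᘁo.blueObj) o.blueObj ≫ (α_ _ _ _).inv)
        ((nestIso ..).hom ≫ (o.redObjᘁ ◁ (w ≫ w')) ▷ (ᘁo.blueObj) ≫ (nestIso ..).inv ≫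
          (ε_ o.redObj o.redObjᘁ ▷ o.top.obj ⊗ₘ ε_ (ᘁo.blueObj) o.blueObj) ≫
            (ρ_ _).hom ≫ (λ_ _).hom) := by
  refine (blockStack_tube ..).trans ?_
  congr 1
  · exact redStack_coevaluation (A := o.redObj) (A' := o.redObjᘁ) f g
  · exact blueStack_coevaluation (B := o.blueObj) (B' := ᘁo.blueObj) f' g'
  · simp only [topStack_apply, MonoidalCategory.whiskerLeft_comp, comp_whiskerRight,
      Category.assoc]

theorem sum_bendTube_blockStack_absorbTube (s t : ℕ) :
    let R := redUnitResolution D s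
    let S := blueUnitResolution D t
    let T := simpleResolution ((o.redObj ⊗ o.top.obj) ⊗ o.blueObj)
    ∑ j, ∑ k, ∑ l, blockStack o _ o
      (bendTube o (R.label j) (S.label k) (T.label l) (R.inj j) (S.inj k) (T.inj l))
      (absorbTube o _ _ _ (R.proj j) (S.proj k) (T.proj l)) = straightTube o := by
  intro R S T
  simp only [bendTube_blockStack_absorbTube, tube, tubeDiagram, ← map_sum, ← tmul_sum, ← sum_tmul,
    ← Preadditive.comp_sum, ← Preadditive.sum_comp, ← whiskerLeft_sum, ← sum_whiskerRight,
    Resolution.total, whiskerLeft_id, id_whiskerRight, Category.id_comp, Iso.hom_inv_id_assoc]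
  refine tube_congr (λ_ _).hom (ε_ o.redObj o.redObjᘁ) (ρ_ _).hom (ε_ (ᘁo.blueObj) o.blueObj)
    (botStack_leftUnit _) ?_ ?_ rfl
  · simp only [Category.assoc]
    exact congrArg _ (ExactPairing.evaluation_coevaluation o.redObj o.redObjᘁ)
  · simp only [Category.assoc]
    exact congrArg _ (ExactPairing.coevaluation_evaluation (ᘁo.blueObj) o.blueObj)

/-- The element of the tube space with a single block. -/
def tubeSingle {m₀ m₁ n₀ n₁ : ℕ} (o : TubeBoundary D m₁ n₁) (i : TubeBoundary D m₀ n₀) :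
    TubeBlock o i →ₗ[ℂ] TubeSpace D m₀ m₁ n₀ n₁ :=
  LinearMap.single ℂ (fun o => ∀ i : TubeBoundary D m₀ n₀, TubeBlock o i) o ∘ₗ
    LinearMap.single ℂ (fun i => TubeBlock o i) i

variable {m₀ m₁ m₂ n₀ n₁ n₂ : ℕ}

theorem tubeStack_tubeSingle (o : TubeBoundary D m₂ n₂) (c : TubeBoundary D m₁ n₁)
    (i : TubeBoundary D m₀ n₀) (X : TubeBlock o c) (Y : TubeBlock c i) :
    tubeStack (tubeSingle o c X) (tubeSingle c i Y) = tubeSingle o i (blockStack o c i X Y) := by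
  funext o' i'
  rw [tubeStack_apply, Finset.sum_eq_single c]
  · by_cases ho : o' = o
    · subst ho
      by_cases hi : i' = i
      · subst hi
        simp [tubeSingle]
      · simp [tubeSingle, hi]
    · simp [tubeSingle, ho]
  · intro c' _ hc
    simp [tubeSingle, hc]
  · exact fun h => absurd (Finset.mem_univ c) h

theorem tubeOne_eq_sum (m n : ℕ) :
    tubeOne D m n = ∑ o, tubeSingle o o (straightTube o) := by
  funext o
  rw [Finset.sum_apply, Finset.sum_eq_single o]
  · simp only [tubeSingle, LinearMap.comp_apply, LinearMap.single_apply, Pi.single_eq_same]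
    rfl
  · intro c _ hc
    simp [tubeSingle, hc.symm]
  · exact fun h => absurd (Finset.mem_univ o) h

theorem tubeOne_mem_range_lift_tubeStack (m n s t : ℕ) :
    tubeOne D m n ∈ LinearMap.range
      (lift (tubeStack : TubeSpace D s m t n →ₗ[ℂ] TubeSpace D m s n t →ₗ[ℂ] _)) := by
  simp only [tubeOne_eq_sum, ← sum_bendTube_blockStack_absorbTube _ s t, map_sum,
    ← tubeStack_tubeSingle]
  exact sum_mem fun o _ => sum_mem fun j _ => sum_mem fun k _ => sum_mem fun l _ =>
    ⟨_ ⊗ₜ _, lift.tmul _ _⟩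

/-! ### The tube bimodules -/

variable (h : TubeLaws D) (m s n t : ℕ)

/-- The Morita context formed by the tube bimodules. -/
def tubeMoritaContext :
    MoritaContext ℂ (TubeAlg h m n) (TubeAlg h s t) (TubeBimod h m s n t)
      (TubeBimod h s m t n) where
  left := (tubeStack : TubeSpace D m s n t →ₗ[ℂ] TubeSpace D s m t n →ₗ[ℂ] TubeSpace D s s t t)
  right := (tubeStack : TubeSpace D s m t n →ₗ[ℂ] TubeSpace D m s n t →ₗ[ℂ] TubeSpace D m m n n)
  left_smul b x y := h.assoc b x y
  left_balanced x a y := h.assoc x a y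
  left_op_smul x y b := (h.assoc x y b).symm
  right_smul b x y := h.assoc b x y
  right_balanced x a y := h.assoc x a y
  right_op_smul x y b := (h.assoc x y b).symm
  left_smul_eq x y x' := h.assoc x y x'
  right_smul_eq x y x' := h.assoc x y x'

instance : SMulCommClass (TubeAlg h s t) (TubeAlg h m n)ᵐᵒᵖ (TubeBimod h m s n t) :=
  ⟨fun a b X => (h.assoc a X b.unop).symm⟩

instance : IsScalarTower ℂ (TubeAlg h s t) (TubeBimod h m s n t) :=
  ⟨fun c a X => LinearMap.map_smul₂ (tubeStack (D := D)) c a X⟩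

instance : IsScalarTower ℂ (TubeAlg h m n)ᵐᵒᵖ (TubeBimod h m s n t) :=
  ⟨fun c a X => map_smul (tubeStack (D := D) X) c a.unop⟩

theorem stackingIsBimoduleIso : StackingIsBimoduleIso h m s n t := by
  let C := tubeMoritaContext h m s n t
  have hC : Function.Bijective C.balancedLift :=
    C.balancedLift_bijective (tubeOne_mem_range_lift_tubeStack s t m n)
  exact ⟨LinearEquiv.ofBijective _ hC, C.balancedLift_tmul, fun a X Y => C.left_smul a X Y,
    fun a X Y => C.left_op_smul X Y a⟩

theorem tubeAlg_isMoritaEquivalent : IsMoritaEquivalent ℂ (TubeAlg h m n) (TubeAlg h s t) :=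
  (tubeMoritaContext h m s n t).isMoritaEquivalent (tubeOne_mem_range_lift_tubeStack s t m n)
    (tubeOne_mem_range_lift_tubeStack m n s t)

end

/-! ### The bulk tube algebra as the algebra of legless tubes -/

section

variable {D : Type u} [Category.{v} D] [Abelian D] [Linear ℂ D] [MonoidalCategory D]

/-- Boundary circles without legs are given by their two vertical edges. -/
def leglessBoundary : Irr D × Irr D ≃ TubeBoundary D 0 0 where
  toFun x := ⟨Fin.elim0, Fin.elim0, x.1, x.2⟩
  invFun o := (o.top, o.bot)
  left_inv _ := rfl
  right_inv _ := TubeBoundary.ext (Subsingleton.elim _ _) (Subsingleton.elim _ _) rfl rfl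

/-- The inclusion of the bulk tubes with simple arcs `k` into the span of all of them. -/
def BulkBlock.of {o i : Irr D × Irr D} (k : Irr D × Irr D) :
    BulkDiagram k.1.obj k.2.obj o i →ₗ[ℂ] BulkBlock o i :=
  DirectSum.lof ℂ (Irr D × Irr D) (fun k => BulkDiagram k.1.obj k.2.obj o i) k

@[elab_as_elim]
theorem BulkBlock.induction {o i : Irr D × Irr D} {motive : BulkBlock o i → Prop} (zero : motive 0)
    (add : ∀ X Y, motive X → motive Y → motive (X + Y))
    (of : ∀ k p q, motive (BulkBlock.of k (p ⊗ₜ q))) (X : BulkBlock o i) : motive X := by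
  refine DirectSum.induction_on X zero (fun k t => ?_) add
  refine TensorProduct.induction_on t ?_ (of k) fun X Y hX hY => ?_
  · exact (map_zero (BulkBlock.of k)).symm ▸ zero
  · exact (map_add (BulkBlock.of k) X Y).symm ▸ add _ _ hX hY

/-- The tube without legs obtained from a bulk tube. -/
def bulkBlockToTube (o i : TubeBoundary D 0 0) :
    BulkBlock (o.top, o.bot) (i.top, i.bot) →ₗ[ℂ] TubeBlock o i :=
  DirectSum.toModule ℂ (Irr D × Irr D) (TubeBlock o i) fun k =>
    TubeBlock.of ⟨k.1, k.1, k.2, k.2⟩ ∘ₗ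
      TensorProduct.map LinearMap.id
        (TensorProduct.mk ℂ (k.1.obj ⊗ i.redObj ⟶ o.redObj ⊗ k.1.obj) _
            ((ρ_ k.1.obj).hom ≫ (λ_ k.1.obj).inv) ∘ₗ
          TensorProduct.mk ℂ (i.blueObj ⊗ k.2.obj ⟶ k.2.obj ⊗ o.blueObj) _
            ((λ_ k.2.obj).hom ≫ (ρ_ k.2.obj).inv))

variable {o c i : TubeBoundary D 0 0}

theorem bulkBlockToTube_of (k : Irr D × Irr D) (p : o.bot.obj ⟶ (k.1.obj ⊗ i.bot.obj) ⊗ k.2.obj)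
    (q : (k.1.obj ⊗ i.top.obj) ⊗ k.2.obj ⟶ o.top.obj) :
    bulkBlockToTube o i (BulkBlock.of k (p ⊗ₜ q)) =
      TubeBlock.of ⟨k.1, k.1, k.2, k.2⟩ (tubeDiagram p ((ρ_ k.1.obj).hom ≫ (λ_ k.1.obj).inv)
        ((λ_ k.2.obj).hom ≫ (ρ_ k.2.obj).inv) q) := by
  simp only [bulkBlockToTube, BulkBlock.of, DirectSum.toModule_lof]
  rfl

theorem bulkToTube_apply (X : BulkTube D) (o i : TubeBoundary D 0 0) :
    bulkToTube X o i = bulkBlockToTube o i (X (o.top, o.bot) (i.top, i.bot)) :=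
  rfl

variable [MonoidalPreadditive D] [MonoidalLinear ℂ D]

/-- Absorbing a red arc without legs into the upper vertical line. -/
def absorbRed (A A' V B Z : D) :
    (A ⊗ 𝟙_ D ⟶ 𝟙_ D ⊗ A') →ₗ[ℂ] ((A' ⊗ V) ⊗ B ⟶ Z) →ₗ[ℂ] ((A ⊗ V) ⊗ B ⟶ Z) :=
  LinearMap.mk₂ ℂ (fun r q => ((ρ_ A).inv ≫ r ≫ (λ_ A').hom) ▷ V ▷ B ≫ q)
    (by intros; simp) (by intros; simp) (by intros; simp) (by intros; simp)

/-- Absorbing a blue arc without legs into the upper vertical line. -/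
def absorbBlue (B B' V Z : D) :
    (𝟙_ D ⊗ B ⟶ B' ⊗ 𝟙_ D) →ₗ[ℂ] (V ⊗ B' ⟶ Z) →ₗ[ℂ] (V ⊗ B ⟶ Z) :=
  LinearMap.mk₂ ℂ (fun s q => V ◁ ((λ_ B).inv ≫ s ≫ (ρ_ B').hom) ≫ q)
    (by intros; simp) (by intros; simp) (by intros; simp) (by intros; simp)

/-- The bulk diagram obtained from a tube diagram without legs by absorbing both arcs into the upper
vertical line. -/
def absorbArcs (A A' B B' : D) (o i : TubeBoundary D 0 0) :
    TubeDiagram A A' B B' o i →ₗ[ℂ] BulkDiagram A B (o.top, o.bot) (i.top, i.bot) :=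
  TensorProduct.map LinearMap.id (lift (absorbRed A A' i.top.obj B o.top.obj) ∘ₗ
    TensorProduct.map LinearMap.id (lift (absorbBlue B B' (A' ⊗ i.top.obj) o.top.obj)))

/-- The bulk tube obtained from a tube without legs. -/
def tubeToBulkBlock (o i : TubeBoundary D 0 0) :
    TubeBlock o i →ₗ[ℂ] BulkBlock (o.top, o.bot) (i.top, i.bot) :=
  DirectSum.toModule ℂ _ _ fun k =>
    BulkBlock.of (k.redBot, k.blueBot) ∘ₗ absorbArcs _ _ _ _ o i

theorem absorbArcs_tubeDiagram {A A' B B' : D} (p : o.bot.obj ⟶ (A ⊗ i.bot.obj) ⊗ B)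
    (r : A ⊗ i.redObj ⟶ o.redObj ⊗ A') (s : i.blueObj ⊗ B ⟶ B' ⊗ o.blueObj)
    (q : (A' ⊗ i.top.obj) ⊗ B' ⟶ o.top.obj) :
    absorbArcs A A' B B' o i (tubeDiagram p r s q) =
      p ⊗ₜ ((((ρ_ A).inv ≫ r ≫ (λ_ A').hom) ▷ i.top.obj ⊗ₘ
        ((λ_ B).inv ≫ s ≫ (ρ_ B').hom)) ≫ q) := by
  rw [MonoidalCategory.tensorHom_def, Category.assoc]
  rfl

theorem tubeToBulkBlock_of (k : TubeArcs D)
    (X : TubeDiagram k.redBot.obj k.redTop.obj k.blueBot.obj k.blueTop.obj o i) :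
    tubeToBulkBlock o i (TubeBlock.of k X) =
      BulkBlock.of (k.redBot, k.blueBot) (absorbArcs _ _ _ _ o i X) := by
  simp only [tubeToBulkBlock, TubeBlock.of, DirectSum.toModule_lof, LinearMap.comp_apply]

theorem tubeToBulkBlock_bulkBlockToTube (X : BulkBlock (o.top, o.bot) (i.top, i.bot)) :
    tubeToBulkBlock o i (bulkBlockToTube o i X) = X := by
  induction X using BulkBlock.induction with
  | zero => simp only [map_zero]
  | add X Y hX hY => simp only [map_add, hX, hY]
  | of k p q =>
    rw [bulkBlockToTube_of, tubeToBulkBlock_of, absorbArcs_tubeDiagram]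
    have absorb_unitors :
        (((ρ_ k.1.obj).inv ≫ ((ρ_ k.1.obj).hom ≫ (λ_ k.1.obj).inv) ≫ (λ_ k.1.obj).hom) ▷
          i.top.obj ⊗ₘ
            (λ_ k.2.obj).inv ≫ ((λ_ k.2.obj).hom ≫ (ρ_ k.2.obj).inv) ≫ (ρ_ k.2.obj).hom) ≫ q =
          q := by simp
    exact congrArg (fun q' => BulkBlock.of k (p ⊗ₜ q')) absorb_unitors

variable [RigidCategory D] [IsMultifusion D]

variable {A B : D}

/-- The tube without legs whose arcs are labelled by the objects `A` and `B`. -/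
def leglessTube (p : o.bot.obj ⟶ (A ⊗ i.bot.obj) ⊗ B) (q : (A ⊗ i.top.obj) ⊗ B ⟶ o.top.obj) :
    TubeBlock o i :=
  tube p ((ρ_ A).hom ≫ (λ_ A).inv) ((λ_ B).hom ≫ (ρ_ B).inv) q

theorem leglessTube_slide {A' B' : D} (f : A ⟶ A') (g : B ⟶ B')
    (p : o.bot.obj ⟶ (A ⊗ i.bot.obj) ⊗ B) (q : (A' ⊗ i.top.obj) ⊗ B' ⟶ o.top.obj) :
    leglessTube (p ≫ (f ▷ i.bot.obj ⊗ₘ g)) q = leglessTube p ((f ▷ i.top.obj ⊗ₘ g) ≫ q) := by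
  refine (tube_congr f f g g rfl ?_ ?_ rfl).symm
  · change ((ρ_ A).hom ≫ (λ_ A).inv) ≫ 𝟙_ D ◁ f = f ▷ 𝟙_ D ≫ (ρ_ A').hom ≫ (λ_ A').inv
    simp
  · change ((λ_ B).hom ≫ (ρ_ B).inv) ≫ g ▷ 𝟙_ D = 𝟙_ D ◁ g ≫ (λ_ B').hom ≫ (ρ_ B').inv
    simp

theorem sum_leglessTube {ι : Type*} (t : Finset ι) (p : o.bot.obj ⟶ (A ⊗ i.bot.obj) ⊗ B)
    (q : ι → ((A ⊗ i.top.obj) ⊗ B ⟶ o.top.obj)) :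
    ∑ j ∈ t, leglessTube p (q j) = leglessTube p (∑ j ∈ t, q j) := by
  simp only [leglessTube, tube, tubeDiagram_sum_top, map_sum]

theorem bulkBlockToTube_of_eq_leglessTube (k : Irr D × Irr D)
    (p : o.bot.obj ⟶ (k.1.obj ⊗ i.bot.obj) ⊗ k.2.obj)
    (q : (k.1.obj ⊗ i.top.obj) ⊗ k.2.obj ⟶ o.top.obj) :
    bulkBlockToTube o i (BulkBlock.of k (p ⊗ₜ q)) = leglessTube p q := by
  rw [bulkBlockToTube_of, TubeBlock.of_tubeDiagram, leglessTube]

theorem tube_eq_leglessTube {A' B' : D} (p : o.bot.obj ⟶ (A ⊗ i.bot.obj) ⊗ B)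
    (r : A ⊗ 𝟙_ D ⟶ 𝟙_ D ⊗ A') (s : 𝟙_ D ⊗ B ⟶ B' ⊗ 𝟙_ D)
    (q : (A' ⊗ i.top.obj) ⊗ B' ⟶ o.top.obj) :
    tube (o := o) (i := i) p r s q = leglessTube p
      ((((ρ_ A).inv ≫ r ≫ (λ_ A').hom) ▷ i.top.obj ⊗ₘ ((λ_ B).inv ≫ s ≫ (ρ_ B').hom)) ≫ q) := by
  refine (tube_congr (𝟙 A) ((ρ_ A).inv ≫ r ≫ (λ_ A').hom) (𝟙 B)
    ((λ_ B).inv ≫ s ≫ (ρ_ B').hom) (by simp) ?_ ?_ rfl).symm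
  · change ((ρ_ A).hom ≫ (λ_ A).inv) ≫ 𝟙_ D ◁ _ = 𝟙 A ▷ 𝟙_ D ≫ r
    monoidal
  · change ((λ_ B).hom ≫ (ρ_ B).inv) ≫ _ ▷ 𝟙_ D = 𝟙_ D ◁ 𝟙 B ≫ s
    simp

theorem bulkBlockToTube_tubeToBulkBlock (X : TubeBlock o i) :
    bulkBlockToTube o i (tubeToBulkBlock o i X) = X := by
  induction X using TubeBlock.induction with
  | zero => simp only [map_zero]
  | add X Y hX hY => simp only [map_add, hX, hY]
  | of k p r s q =>
    rw [tubeToBulkBlock_of, absorbArcs_tubeDiagram, bulkBlockToTube_of_eq_leglessTube,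
      TubeBlock.of_tubeDiagram]
    exact (tube_eq_leglessTube p r s q).symm

theorem bulkParallelMove_tmul {o i : Irr D × Irr D} (p : o.2.obj ⟶ (A ⊗ i.2.obj) ⊗ B)
    (q : (A ⊗ i.1.obj) ⊗ B ⟶ o.1.obj) :
    let R := simpleResolution A
    let S := simpleResolution B
    bulkParallelMove A B o i (p ⊗ₜ q) =
      ∑ x : R.ι × S.ι, BulkBlock.of (R.label x.1, S.label x.2)
        ((p ≫ (R.proj x.1 ▷ i.2.obj ⊗ₘ S.proj x.2)) ⊗ₜ
          ((R.inj x.1 ▷ i.1.obj ⊗ₘ S.inj x.2) ≫ q)) := by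
  intro R S
  simp only [bulkParallelMove, LinearMap.sum_apply, Fintype.sum_prod_type]
  rfl

theorem bulkBlockToTube_bulkParallelMove (p : o.bot.obj ⟶ (A ⊗ i.bot.obj) ⊗ B)
    (q : (A ⊗ i.top.obj) ⊗ B ⟶ o.top.obj) :
    bulkBlockToTube o i (bulkParallelMove A B (o.top, o.bot) (i.top, i.bot) (p ⊗ₜ q)) =
      leglessTube p q := by
  rw [bulkParallelMove_tmul (o := (o.top, o.bot)) (i := (i.top, i.bot)) p q, map_sum]
  have collect (x : (simpleResolution A).ι × (simpleResolution B).ι) :=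
    (bulkBlockToTube_of_eq_leglessTube (o := o) (i := i) (_, _) _ _).trans
      (leglessTube_slide ((simpleResolution A).proj x.1) ((simpleResolution B).proj x.2) p
        (((simpleResolution A).inj x.1 ▷ i.top.obj ⊗ₘ (simpleResolution B).inj x.2) ≫ q))
  refine (Finset.sum_congr rfl fun x _ => collect x).trans ?_
  rw [sum_leglessTube]
  simp only [← Category.assoc, ← Preadditive.sum_comp, Resolution.sum_flank, Category.id_comp]

theorem blockStack_leglessTube {A₂ B₂ : D} (p : o.bot.obj ⟶ (A ⊗ c.bot.obj) ⊗ B)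
    (q : (A ⊗ c.top.obj) ⊗ B ⟶ o.top.obj) (p₂ : c.bot.obj ⟶ (A₂ ⊗ i.bot.obj) ⊗ B₂)
    (q₂ : (A₂ ⊗ i.top.obj) ⊗ B₂ ⟶ c.top.obj) :
    blockStack o c i (leglessTube p q) (leglessTube p₂ q₂) =
      leglessTube (botStack _ _ _ _ _ _ _ p p₂) (topStack _ _ _ _ _ _ _ q q₂) := by
  refine (blockStack_tube ..).trans ?_
  rw [leglessTube]
  congr 1
  · change redStack A A A₂ A₂ (𝟙_ D) (𝟙_ D) (𝟙_ D) ((ρ_ A).hom ≫ (λ_ A).inv)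
      ((ρ_ A₂).hom ≫ (λ_ A₂).inv) = (ρ_ (A ⊗ A₂)).hom ≫ (λ_ (A ⊗ A₂)).inv
    rw [redStack_apply]
    monoidal
  · change blueStack B B B₂ B₂ (𝟙_ D) (𝟙_ D) (𝟙_ D) ((λ_ B).hom ≫ (ρ_ B).inv)
      ((λ_ B₂).hom ≫ (ρ_ B₂).inv) = (λ_ (B₂ ⊗ B)).hom ≫ (ρ_ (B₂ ⊗ B)).inv
    rw [blueStack_apply]
    monoidal

theorem bulkBlockStack_of_of {o c i : Irr D × Irr D} (k k₂ : Irr D × Irr D)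
    (p : o.2.obj ⟶ (k.1.obj ⊗ c.2.obj) ⊗ k.2.obj) (q : (k.1.obj ⊗ c.1.obj) ⊗ k.2.obj ⟶ o.1.obj)
    (p₂ : c.2.obj ⟶ (k₂.1.obj ⊗ i.2.obj) ⊗ k₂.2.obj)
    (q₂ : (k₂.1.obj ⊗ i.1.obj) ⊗ k₂.2.obj ⟶ c.1.obj) :
    bulkBlockStack o c i (BulkBlock.of k (p ⊗ₜ q)) (BulkBlock.of k₂ (p₂ ⊗ₜ q₂)) =
      bulkParallelMove _ _ o i
        (botStack _ _ _ _ _ _ _ p p₂ ⊗ₜ topStack _ _ _ _ _ _ _ q q₂) := by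
  simp only [bulkBlockStack, BulkBlock.of, DirectSum.toModule_lof, LinearMap.flip_apply,
    LinearMap.compr₂_apply, TensorProduct.map₂_apply_tmul, TensorProduct.map_tmul]

theorem bulkBlockToTube_bulkBlockStack (X : BulkBlock (o.top, o.bot) (c.top, c.bot))
    (Y : BulkBlock (c.top, c.bot) (i.top, i.bot)) :
    bulkBlockToTube o i (bulkBlockStack _ _ _ X Y) =
      blockStack o c i (bulkBlockToTube o c X) (bulkBlockToTube c i Y) := by
  induction X using BulkBlock.induction with
  | zero => simp only [map_zero, LinearMap.zero_apply]
  | add X X' hX hX' => simp only [map_add, LinearMap.add_apply, hX, hX']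
  | of k p q =>
    induction Y using BulkBlock.induction with
    | zero => simp only [map_zero]
    | add Y Y' hY hY' => simp only [map_add, hY, hY']
    | of k₂ p₂ q₂ =>
      rw [bulkBlockStack_of_of, bulkBlockToTube_bulkParallelMove, bulkBlockToTube_of_eq_leglessTube,
        bulkBlockToTube_of_eq_leglessTube, blockStack_leglessTube]

theorem bulkToTube_bulkMul (X Y : BulkTube D) :
    bulkToTube (bulkMul X Y) = tubeStack (bulkToTube X) (bulkToTube Y) := by
  funext o i
  rw [tubeStack_apply, bulkToTube_apply, bulkMul, map_sum, ← leglessBoundary.sum_comp]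
  exact Finset.sum_congr rfl fun c _ =>
    bulkBlockToTube_bulkBlockStack (c := leglessBoundary c) _ _

theorem leglessTube_unit (o : TubeBoundary D 0 0) :
    leglessTube ((λ_ o.bot.obj).inv ≫ (ρ_ _).inv) ((ρ_ _).hom ≫ (λ_ o.top.obj).hom) =
      straightTube o := by
  rw [leglessTube, straightTube]
  congr 1
  · change (ρ_ (𝟙_ D)).hom ≫ (λ_ (𝟙_ D)).inv = (λ_ (𝟙_ D)).hom ≫ (ρ_ (𝟙_ D)).inv
    rw [unitors_equal, unitors_inv_equal]
  · change (λ_ (𝟙_ D)).hom ≫ (ρ_ (𝟙_ D)).inv = (ρ_ (𝟙_ D)).hom ≫ (λ_ (𝟙_ D)).inv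
    rw [unitors_equal, unitors_inv_equal]

theorem bulkToTube_bulkOne : bulkToTube (bulkOne D) = tubeOne D 0 0 := by
  funext o i
  rw [bulkToTube_apply, bulkOne]
  obtain rfl | h := eq_or_ne i o
  · rw [Pi.single_eq_same, bulkBlockToTube_bulkParallelMove, leglessTube_unit, tubeOne_self]
  · have h' : (i.top, i.bot) ≠ (o.top, o.bot) := leglessBoundary.symm.injective.ne h
    rw [Pi.single_eq_of_ne h', map_zero, tubeOne_of_ne h]

variable (D) in
theorem bulkToTube_bijective : Function.Bijective (bulkToTube (D := D)) := by
  let tubeToBulk (Z : TubeSpace D 0 0 0 0) : BulkTube D := fun o i =>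
    tubeToBulkBlock (leglessBoundary o) (leglessBoundary i) (Z _ _)
  refine ⟨Function.LeftInverse.injective (g := tubeToBulk) fun X => ?_,
    Function.RightInverse.surjective (g := tubeToBulk) fun Z => ?_⟩
  · funext o i
    exact tubeToBulkBlock_bulkBlockToTube (o := leglessBoundary o) (i := leglessBoundary i) _
  · funext o i
    obtain ⟨o, rfl⟩ := leglessBoundary.surjective o
    obtain ⟨i, rfl⟩ := leglessBoundary.surjective i
    exact bulkBlockToTube_tubeToBulkBlock _

end

end

theorem mainTheorem6 (D : Type u) [Category.{v} D] [Abelian D] [Linear ℂ D] [MonoidalCategory D]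
    [MonoidalPreadditive D] [MonoidalLinear ℂ D] [RigidCategory D] [IsMultifusion D] :
    ∃ h : TubeLaws D,
      (∀ m s n t : ℕ,
        SMulCommClass (TubeAlg h s t) (TubeAlg h m n)ᵐᵒᵖ (TubeBimod h m s n t) ∧
        IsScalarTower ℂ (TubeAlg h s t) (TubeBimod h m s n t) ∧
        IsScalarTower ℂ (TubeAlg h m n)ᵐᵒᵖ (TubeBimod h m s n t)) ∧
      (∀ m s n t : ℕ, StackingIsBimoduleIso h m s n t ∧ StackingIsBimoduleIso h s m t n) ∧
      (∀ m s n t : ℕ, IsMoritaEquivalent ℂ (TubeAlg h m n) (TubeAlg h s t)) ∧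
      ∃ e : BulkTube D ≃ₗ[ℂ] TubeAlg h 0 0,
        (∀ X, e X = bulkToTube X) ∧ (∀ X Y, e (bulkMul X Y) = e X * e Y) ∧ e (bulkOne D) = 1 :=
  ⟨tubeLaws, fun _ _ _ _ => ⟨inferInstance, inferInstance, inferInstance⟩,
    fun m s n t => ⟨stackingIsBimoduleIso _ m s n t, stackingIsBimoduleIso _ s m t n⟩,
    fun m s n t => tubeAlg_isMoritaEquivalent _ m s n t,
    LinearEquiv.ofBijective bulkToTube (bulkToTube_bijective D), fun _ => rfl,
    bulkToTube_bulkMul, bulkToTube_bulkOne⟩
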